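/- Let $n\ge 3$, $a>0$, and $\tfrac12<\sigma<4(n-2)^2$. For $r\ge 0$ put $g(r)=(1+ar^2)^{-\sigma/2}$, $f(r)=\int_0^r g(s)^2\,ds$, $F(r)=\int_0^r f(t)\,dt$, and for $c\in\mathbb{R}^n$ put $F_c(x)=F(|x-c|)$ and $$\gamma_c = i[-\Delta,F_c] = -i\sum_{j=1}^n\bigl(\partial_j\,(\partial_jF_c)+(\partial_jF_c)\,\partial_j\bigr).$$ For $k\in\mathbb{Z}$ let $b_k=(k,0,\dots,0)\in\mathbb{R}^n$, and for an integer $N\ge 0$ let $\gamma_N=\sum_{k=-N}^{N}\gamma_{b_k}$. Let $M\ge 0$ be an integer and let $V_j$, $-M\le j\le M$, be real-valued functions on $[0,\infty)$ that are non-increasing and such that $x\mapsto V_j(|x-b_j|)$ is smooth and compactly supported on $\mathbb{R}^n$. Let $$H=-\Delta+\sum_{j=-M}^{M}V_j(|x-b_j|)$$ on $L^2(\mathbb{R}^n;\mathbb{C})$. Then for every $\varepsilon\in(0,1)$ there is an integer $N_\varepsilon\ge M$ such that for all integers $N\ge N_\varepsilon$ $$ i[H,\gamma_N]\ \ge\ (1-\varepsilon)\,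 i[-\Delta,\gamma_N] $$ in the sense of quadratic forms on $D(-\Delta)=H^2(\mathbb{R}^n)$; that is, every $u\in D(-\Delta)$ lies in $D(H)$ and satisfies $\gamma_Nu\in L^2$, and $$ i\bigl(\langle Hu,\gamma_Nu\rangle-\langle\gamma_Nu,Hu\rangle\bigr)\ \ge\ (1-\varepsilon)\,i\bigl(\langle-\Delta u,\gamma_Nu\rangle-\langle\gamma_Nu,-\Delta u\rangle\bigr), $$ where $\langle\cdot,\cdot\rangle$ is the $L^2$ inner product, conjugate-linear in the first argument. -/

import Mathlib

open MeasureTheory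
open scoped SchwartzMap

noncomputable section

namespace MultiCenter

/-- The Euclidean space `ℝⁿ`. -/
abbrev Space (n : ℕ) : Type := EuclideanSpace ℝ (Fin n)

/-- The Hilbert space `L²(ℝⁿ; ℂ)`. -/
abbrev L2 (n : ℕ) : Type := Lp ℂ 2 (volume : Measure (Space n))

/-- The tempered distributions on `ℝⁿ`. -/
abbrev Dist (n : ℕ) : Type := 𝓢'(Space n, ℂ)

/-- The embedding of `L²(ℝⁿ; ℂ)` into the tempered distributions, `u ↦ (φ ↦ ∫ φ u)`. -/
def toDist (n : ℕ) : L2 n →ₗ[ℂ] Dist n :=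
  (Lp.toTemperedDistributionCLM ℂ (volume : Measure (Space n)) 2 : L2 n →L[ℂ] Dist n)

theorem toDist_injective (n : ℕ) : Function.Injective (toDist n) :=
  LinearMap.ker_eq_bot.1 Lp.ker_toTemperedDistributionCLM_eq_bot

/-- The (maximal) realization in `L²` of an operator `T` acting on distributions: its domain is
`{u ∈ L² : T u ∈ L²}`, and it maps `u` to the `L²` function that represents `T u`. -/
def realize {n : ℕ} (T : Dist n →ₗ[ℂ] Dist n) : L2 n →ₗ.[ℂ] L2 n where
  domain := (LinearMap.range (toDist n)).comap (T ∘ₗ toDist n)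
  toFun := (LinearEquiv.ofInjective (toDist n) (toDist_injective n)).symm.toLinearMap ∘ₗ
    ((T ∘ₗ toDist n).domRestrict _).codRestrict (LinearMap.range (toDist n)) fun u => u.2

theorem mem_domain_realize {n : ℕ} (T : Dist n →ₗ[ℂ] Dist n) (u : L2 n) :
    u ∈ (realize T).domain ↔ ∃ w : L2 n, toDist n w = T (toDist n u) :=
  Iff.rfl

theorem toDist_realize {n : ℕ} (T : Dist n →ₗ[ℂ] Dist n) (u : (realize T).domain) :
    toDist n (realize T u) = T (toDist n u) :=
  congrArg Subtype.val ((LinearEquiv.ofInjective (toDist n) (toDist_injective n)).apply_symm_apply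
    ⟨T (toDist n u), u.2⟩)

/-- The distributional partial derivative `∂ⱼ`. -/
def partialD {n : ℕ} (j : Fin n) : Dist n →ₗ[ℂ] Dist n :=
  (LineDeriv.lineDerivOpCLM ℂ (Dist n) (EuclideanSpace.single j (1 : ℝ) : Space n) :
    Dist n →L[ℂ] Dist n)

/-- Multiplication of distributions by a real function `G` (smooth, with all derivatives of at most
polynomial growth, in every use below). -/
def mulBy {n : ℕ} (G : Space n → ℝ) : Dist n →ₗ[ℂ] Dist n :=
  (TemperedDistribution.smulLeftCLM ℂ (fun x => (G x : ℂ)) : Dist n →L[ℂ] Dist n)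

/-- `-Δ = -∑ⱼ ∂ⱼ²` on distributions. -/
def negLaplacianDist (n : ℕ) : Dist n →ₗ[ℂ] Dist n :=
  -∑ j, partialD j ∘ₗ partialD j

/-- The free Hamiltonian `-Δ` on `L²`, with domain `D(-Δ) = {u ∈ L² : Δu ∈ L²} = H²(ℝⁿ)`. -/
def negLaplacian (n : ℕ) : L2 n →ₗ.[ℂ] L2 n :=
  realize (negLaplacianDist n)

/-- The Schrödinger operator `-Δ + V` on `L²`. -/
def hamiltonian {n : ℕ} (V : Space n → ℝ) : L2 n →ₗ.[ℂ] L2 n :=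
  realize (negLaplacianDist n + mulBy V)

/-- `g(r) = (1 + a r²)^(-σ/2)`. -/
def g (a σ r : ℝ) : ℝ := 1 / (1 + a * r ^ 2) ^ (σ / 2)

/-- `f(r) = ∫₀ʳ g(s)² ds`. -/
def f (a σ r : ℝ) : ℝ := ∫ s in (0 : ℝ)..r, g a σ s ^ 2

/-- `F(r) = ∫₀ʳ f(t) dt`. -/
def F (a σ r : ℝ) : ℝ := ∫ t in (0 : ℝ)..r, f a σ t

/-- `F_c(x) = F(|x - c|)`. -/
def Fc {n : ℕ} (a σ : ℝ) (c x : Space n) : ℝ := F a σ ‖x - c‖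

/-- The classical partial derivative `∂ⱼ F_c`. -/
def gradFc {n : ℕ} (a σ : ℝ) (c : Space n) (j : Fin n) (x : Space n) : ℝ :=
  fderiv ℝ (Fc a σ c) x (EuclideanSpace.single j 1)

/-- The multiplier centered at `c`, `γ_c = -i ∑ⱼ (∂ⱼ (∂ⱼF_c) + (∂ⱼF_c) ∂ⱼ)`, on distributions. -/
def gammaDist {n : ℕ} (a σ : ℝ) (c : Space n) : Dist n →ₗ[ℂ] Dist n :=
  (-Complex.I) • ∑ j, (partialD j ∘ₗ mulBy (gradFc a σ c j) + mulBy (gradFc a σ c j) ∘ₗ partialD j)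

/-- The lattice point `(j, 0, …, 0)` of `ℝⁿ`. -/
def latticePoint (n : ℕ) (j : ℤ) : Space n :=
  WithLp.toLp 2 fun i => if i.val = 0 then (j : ℝ) else 0

/-- The multi-centered multiplier `γ_N = ∑_{k=-N}^{N} γ_{c_k}` with `c_k = (k, 0, …, 0)`, on `L²`. -/
def gammaN (n : ℕ) (a σ : ℝ) (N : ℕ) : L2 n →ₗ.[ℂ] L2 n :=
  realize (∑ k ∈ Finset.Icc (-(N : ℤ)) N, gammaDist a σ (latticePoint n k))

/-- The bump `x ↦ v(|x - b_j|)` at the lattice point `b_j = (j, 0, …, 0)`. -/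
def bump (n : ℕ) (v : ℝ → ℝ) (j : ℤ) (x : Space n) : ℝ := v ‖x - latticePoint n j‖

/-- The lattice potential `∑_{j=-M}^{M} V_j(|x - b_j|)`. -/
def latticePotential (n M : ℕ) (V : ℤ → ℝ → ℝ) (x : Space n) : ℝ :=
  ∑ j ∈ Finset.Icc (-(M : ℤ)) M, bump n (V j) j x

/-- The quadratic form of the commutator `i[A, B] = i(AB - BA)` of two symmetric operators, at
`u ∈ D(A) ∩ D(B)`: the number `i (⟨Au, Bu⟩ - ⟨Bu, Au⟩)`, which is real because it equals
`-2 Im ⟨Au, Bu⟩`. -/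
def commForm {n : ℕ} (A B : L2 n →ₗ.[ℂ] L2 n) (u : L2 n) (hA : u ∈ A.domain) (hB : u ∈ B.domain) :
    ℝ :=
  (Complex.I * (inner ℂ (A ⟨u, hA⟩) (B ⟨u, hB⟩) - inner ℂ (B ⟨u, hB⟩) (A ⟨u, hA⟩))).re

end MultiCenter

end

/-! Let F_N be the sum of the F_{b_k} and V the whole potential. On Schwartz functions i[-Δ,γ_N] is
the form 4 ∑ Re⟨∂ⱼu, (∂ⱼ∂ₖF_N) ∂ₖu⟩ - ⟨u, (Δ²F_N) u⟩, and i[V,γ_N] is multiplication by -2 ∇V·∇F_N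
(`virial`, `virial_potential`). The claim is that ε i[-Δ,γ_N] + i[V,γ_N] ≥ 0 for large N.

Free part. The Hessian of each F_b is at least the weight g². The potential -Δ²F_b may be negative,
but a weighted Hardy inequality absorbs it exactly when σ/4 < (n-2)². So each i[-Δ,γ_b] dominates a
fixed multiple of a weighted energy (`exists_energy_le`). All centers contribute nonnegatively, and
keeping the center 0 alone gives a bound independent of N.

Potential part. Since V_j decreases, -2 ∇V_j·∇F_N is a nonnegative factor times (x-b_j)·∇F_N(x).
Pair the centers symmetrically about b_j: each pair contributes at least the squared distance of x
to the lattice line times a factor decaying only like the inverse distance to the centers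
(`pair_field_ge`, `radK_lower`). These contributions sum to a divergent harmonic series, while at
most 2M centers stay unpaired and their effect is bounded uniformly in N because f is bounded (here
σ > 1/2 is used). So, as soon as N is large, the potential commutator can be negative only in a
bounded piece of the slab |x₁| < δ, x₁ being a coordinate transversal to the line, and there it is
at least -C with C independent of δ and N (`exists_potential_bound`).

Conclusion. The mass of u in such a slab is at most a constant times δ times the energy
(`exists_slab_le`), so a small δ lets ε i[-Δ,γ_N] absorb the negative part
(`exists_schwartz_inequality`). Schwartz functions are dense in D(-Δ) for the graph norm, and V and
γ_N are bounded relative to -Δ, so the inequality passes to the limit. -/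

namespace MultiCenter

/-! ### Averages along rays: smoothness and growth without a singularity at the origin. -/

section RadialAverage

variable {E G : Type} [NormedAddCommGroup E] [NormedSpace ℝ E] [NormedAddCommGroup G]
  [NormedSpace ℝ G]

/-- The weighted average `∫₀¹ tʲ p(t y) dt` of `p` along the segment from `0` to `y`. -/
noncomputable def radAvg (j : ℕ) (p : E → G) (y : E) : G := ∫ t in (0 : ℝ)..1, t ^ j • p (t • y)

theorem intervalIntegrable_radAvg (j : ℕ) {p : E → G} (hp : Continuous p) (y : E) (b c : ℝ) :
    IntervalIntegrable (fun t : ℝ => t ^ j • p (t • y)) volume b c :=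
  Continuous.intervalIntegrable (by fun_prop) _ _

theorem norm_radAvg_le (j : ℕ) {p : E → G} {y : E} {C : ℝ}
    (h : ∀ t ∈ Set.Icc (0 : ℝ) 1, ‖p (t • y)‖ ≤ C) : ‖radAvg j p y‖ ≤ C := by
  have := intervalIntegral.norm_integral_le_of_norm_le_const (a := (0 : ℝ)) (b := 1) (C := C)
    (f := fun t : ℝ => t ^ j • p (t • y)) (fun t ht => ?_)
  · simpa [radAvg] using this
  · rw [Set.uIoc_of_le zero_le_one] at ht
    rw [norm_smul, norm_pow, Real.norm_of_nonneg ht.1.le]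
    calc t ^ j * ‖p (t • y)‖ ≤ 1 * ‖p (t • y)‖ := by
          gcongr
          exact pow_le_one₀ ht.1.le ht.2
      _ ≤ C := by simpa using h t ⟨ht.1.le, ht.2⟩

/-- Differentiating `p (t • y)` in `y` brings out a factor `t`; this is why the power of `t` is a
parameter. -/
theorem hasFDerivAt_radAvg (j : ℕ) {p : E → G} (hp : p.HasTemperateGrowth) (y : E) :
    HasFDerivAt (radAvg j p) (radAvg (j + 1) (fderiv ℝ p) y) y := by
  have hd : Differentiable ℝ p := hp.1.differentiable (by simp)
  have hc : Continuous (fderiv ℝ p) := hp.1.continuous_fderiv (by simp)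
  have hpc := hp.1.continuous
  obtain ⟨k, C, hC⟩ := hp.2 1
  have hC0 : 0 ≤ C := by simpa using (norm_nonneg _).trans (hC 0)
  refine intervalIntegral.hasFDerivAt_integral_of_dominated_of_fderiv_le
    (F := fun y t => t ^ j • p (t • y)) (F' := fun y t => t ^ (j + 1) • fderiv ℝ p (t • y))
    (bound := fun _ => C * (1 + (1 + ‖y‖)) ^ k) (Metric.ball_mem_nhds y one_pos)
    (Filter.Eventually.of_forall fun x => ?_) (intervalIntegrable_radAvg j hpc y 0 1) ?_ ?_
    (by simp) ?_
  · exact Continuous.aestronglyMeasurable (by fun_prop)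
  · exact Continuous.aestronglyMeasurable (by fun_prop)
  · refine Filter.Eventually.of_forall fun t ht x hx => ?_
    rw [Set.uIoc_of_le zero_le_one] at ht
    have hx' : ‖x‖ ≤ 1 + ‖y‖ := by
      have := norm_le_norm_add_norm_sub y x
      rw [Metric.mem_ball, dist_eq_norm, norm_sub_rev] at hx
      linarith
    rw [norm_smul, norm_pow, Real.norm_of_nonneg ht.1.le]
    have h1 : ‖fderiv ℝ p (t • x)‖ ≤ C * (1 + ‖t • x‖) ^ k := by
      simpa [← norm_iteratedFDeriv_fderiv] using hC (t • x)
    have h2 : ‖t • x‖ ≤ 1 + ‖y‖ := by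
      rw [norm_smul, Real.norm_of_nonneg ht.1.le]
      nlinarith [norm_nonneg x, ht.2]
    calc t ^ (j + 1) * ‖fderiv ℝ p (t • x)‖ ≤ 1 * (C * (1 + ‖t • x‖) ^ k) := by
          gcongr
          exact pow_le_one₀ ht.1.le ht.2
      _ ≤ C * (1 + (1 + ‖y‖)) ^ k := by rw [one_mul]; gcongr
  · refine Filter.Eventually.of_forall fun t _ x _ => ?_
    have h1 : HasFDerivAt (fun x : E => t • x) (t • ContinuousLinearMap.id ℝ E) x :=
      (hasFDerivAt_id x).const_smul t
    have h2 := ((hd (t • x)).hasFDerivAt.comp x h1).const_smul (t ^ j)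
    refine h2.congr_fderiv ?_
    rw [ContinuousLinearMap.comp_smul, ContinuousLinearMap.comp_id, smul_smul, pow_succ]

theorem fderiv_radAvg (j : ℕ) {p : E → G} (hp : p.HasTemperateGrowth) :
    fderiv ℝ (radAvg j p) = radAvg (j + 1) (fderiv ℝ p) :=
  funext fun y => (hasFDerivAt_radAvg j hp y).fderiv

theorem hasTemperateGrowth_fderiv {p : E → G} (hp : p.HasTemperateGrowth) :
    (fderiv ℝ p).HasTemperateGrowth := by
  refine ⟨hp.1.fderiv_right (by simp), fun m => ?_⟩
  obtain ⟨k, C, h⟩ := hp.2 (m + 1)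
  exact ⟨k, C, fun x => by simpa [norm_iteratedFDeriv_fderiv] using h x⟩

/-- The target space is quantified inside the induction because the induction hypothesis is applied
to `fderiv ℝ p`, which takes values in another space. -/
theorem contDiff_radAvg_nat (m : ℕ) : ∀ {G : Type} [NormedAddCommGroup G] [NormedSpace ℝ G]
    (j : ℕ) {p : E → G}, p.HasTemperateGrowth → ContDiff ℝ m (radAvg j p) ∧
      ∃ (k : ℕ) (C : ℝ), ∀ x, ‖iteratedFDeriv ℝ m (radAvg j p) x‖ ≤ C * (1 + ‖x‖) ^ k := by
  induction m with
  | zero =>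
    intro G _ _ j p hp
    refine ⟨contDiff_zero.2 (Differentiable.continuous (𝕜 := ℝ)
      fun y => (hasFDerivAt_radAvg j hp y).differentiableAt), ?_⟩
    obtain ⟨k, C, hC⟩ := hp.2 0
    have hC0 : 0 ≤ C := by simpa using (norm_nonneg _).trans (hC 0)
    refine ⟨k, C, fun x => ?_⟩
    rw [norm_iteratedFDeriv_zero]
    refine norm_radAvg_le j fun t ht => ?_
    have h1 := hC (t • x)
    rw [norm_iteratedFDeriv_zero] at h1
    refine h1.trans ?_
    gcongr
    rw [norm_smul, Real.norm_of_nonneg ht.1]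
    exact mul_le_of_le_one_left (norm_nonneg x) ht.2
  | succ m ih =>
    intro G _ _ j p hp
    obtain ⟨h1, k, C, h2⟩ := ih (j + 1) (hasTemperateGrowth_fderiv hp)
    rw [← fderiv_radAvg j hp] at h1 h2
    refine ⟨?_, k, C, fun x => ?_⟩
    · push_cast
      exact contDiff_succ_iff_fderiv.2
        ⟨fun y => (hasFDerivAt_radAvg j hp y).differentiableAt, by simp, h1⟩
    · simpa [norm_iteratedFDeriv_fderiv] using h2 x

theorem hasTemperateGrowth_radAvg (j : ℕ) {p : E → G} (hp : p.HasTemperateGrowth) :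
    (radAvg j p).HasTemperateGrowth :=
  ⟨contDiff_infty.2 fun m => (contDiff_radAvg_nat m j hp).1,
    fun m => (contDiff_radAvg_nat m j hp).2⟩

/-- Euler's relation for radial averages. -/
theorem radAvg_euler [CompleteSpace G] (j : ℕ) {p : E → G} (hp : p.HasTemperateGrowth) (y : E) :
    ((j : ℝ) + 1) • radAvg j p y + fderiv ℝ (radAvg j p) y y = p y := by
  have hd : Differentiable ℝ p := hp.1.differentiable (by simp)
  have hc : Continuous (fderiv ℝ p) := hp.1.continuous_fderiv (by simp)
  have hpc := hp.1.continuous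
  -- Euler's relation is the fundamental theorem of calculus for `t ^ (j + 1) • p (t • y)` on [0,
  -- 1].
  have h1 : ∀ t ∈ Set.uIcc (0 : ℝ) 1, HasDerivAt (fun t : ℝ => t ^ (j + 1) • p (t • y))
      (((j : ℝ) + 1) • t ^ j • p (t • y) + t ^ (j + 1) • fderiv ℝ p (t • y) y) t := by
    intro t _
    have ha : HasDerivAt (fun t : ℝ => t • y) y t := by
      simpa using (hasDerivAt_id t).smul_const y
    have hb := (hd (t • y)).hasFDerivAt.comp_hasDerivAt t ha
    have hcc := (hasDerivAt_pow (j + 1) t).smul hb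
    refine hcc.congr_deriv ?_
    simp [smul_smul, add_comm]
  have h2 := intervalIntegral.integral_eq_sub_of_hasDerivAt h1
    (Continuous.intervalIntegrable (by fun_prop) _ _)
  rw [intervalIntegral.integral_add (Continuous.intervalIntegrable (by fun_prop) _ _)
    (Continuous.intervalIntegrable (by fun_prop) _ _), intervalIntegral.integral_smul] at h2
  rw [fderiv_radAvg j hp, radAvg, radAvg,
    ContinuousLinearMap.intervalIntegral_apply (intervalIntegrable_radAvg (j + 1) hc y 0 1)]
  simpa using h2

end RadialAverage

/-! ### Calculus of radial functions; the weight g², the quotient f(r)/r and its derivatives. -/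

section RadialCalculus

variable {n : ℕ}

/-- `p` is differentiable with gradient `c y • y` at `y`. -/
def HasRadialGrad (p c : Space n → ℝ) : Prop :=
  ∀ y, HasFDerivAt p (c y • innerSL ℝ y) y

theorem HasRadialGrad.const_mul {p c : Space n → ℝ} (h : HasRadialGrad p c) (b : ℝ) :
    HasRadialGrad (fun y => b * p y) (fun y => b * c y) := fun y => by
  simpa [smul_smul] using (h y).const_mul b

theorem HasRadialGrad.add {p c p' c' : Space n → ℝ} (h : HasRadialGrad p c)
    (h' : HasRadialGrad p' c') : HasRadialGrad (fun y => p y + p' y) (fun y => c y + c' y) :=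
  fun y => by simpa [add_smul] using (h y).fun_add (h' y)

theorem HasRadialGrad.mul {p c p' c' : Space n → ℝ} (h : HasRadialGrad p c)
    (h' : HasRadialGrad p' c') :
    HasRadialGrad (fun y => p y * p' y) (fun y => p y * c' y + p' y * c y) :=
  fun y => by simpa [add_smul, smul_smul] using (h y).fun_mul (h' y)

theorem hasRadialGrad_norm_sq : HasRadialGrad (fun y : Space n => ‖y‖ ^ 2) (fun _ => 2) :=
  fun y => by
    refine (hasStrictFDerivAt_norm_sq y).hasFDerivAt.congr_fderiv ?_
    rw [two_smul, two_smul]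

theorem HasRadialGrad.radAvg {p c : Space n → ℝ} (h : HasRadialGrad p c)
    (hp : p.HasTemperateGrowth) (j : ℕ) :
    HasRadialGrad (radAvg j p) (radAvg (j + 2) c) := fun y => by
  refine (hasFDerivAt_radAvg j hp y).congr_fderiv ?_
  ext v
  have hc' : Continuous (fderiv ℝ p) := hp.1.continuous_fderiv (by simp)
  rw [MultiCenter.radAvg,
    ContinuousLinearMap.intervalIntegral_apply (intervalIntegrable_radAvg (j + 1) hc' y 0 1)]
  simp only [smul_apply, (h _).fderiv, innerSL_apply_apply, smul_eq_mul,
    MultiCenter.radAvg]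
  rw [← intervalIntegral.integral_mul_const]
  refine intervalIntegral.integral_congr fun t _ => ?_
  simp only [real_inner_smul_left]
  ring

/-- Used to eliminate `‖y‖ ^ 2` times an averaged gradient coefficient, so that no identity below
has to divide by `‖y‖`. -/
theorem HasRadialGrad.radAvg_euler {p c : Space n → ℝ} (h : HasRadialGrad p c)
    (hp : p.HasTemperateGrowth) (j : ℕ) (y : Space n) :
    ((j : ℝ) + 1) * MultiCenter.radAvg j p y + MultiCenter.radAvg (j + 2) c y * ‖y‖ ^ 2 = p y := by
  have := MultiCenter.radAvg_euler j hp y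
  rw [((h.radAvg hp j) y).fderiv] at this
  simpa [real_inner_self_eq_norm_sq] using this

/-- The weight `(1 + a |y|²)^(-s)`. -/
noncomputable def wt (a s : ℝ) (y : Space n) : ℝ := (1 + a * ‖y‖ ^ 2) ^ (-s)

variable {a : ℝ}

theorem wt_base_pos (ha : 0 < a) (y : Space n) : 0 < 1 + a * ‖y‖ ^ 2 := by positivity

theorem wt_pos (ha : 0 < a) (s : ℝ) (y : Space n) : 0 < wt a s y :=
  Real.rpow_pos_of_pos (wt_base_pos ha y) _

theorem wt_le_one (ha : 0 < a) {s : ℝ} (hs : 0 ≤ s) (y : Space n) : wt a s y ≤ 1 :=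
  Real.rpow_le_one_of_one_le_of_nonpos (by nlinarith [sq_nonneg ‖y‖]) (by linarith)

theorem wt_succ_mul (ha : 0 < a) (s : ℝ) (y : Space n) :
    wt a (s + 1) y * (1 + a * ‖y‖ ^ 2) = wt a s y := by
  have h := wt_base_pos ha y
  have h1 : -s = -(s + 1) + 1 := by ring
  rw [wt, wt, h1, Real.rpow_add h, Real.rpow_one]

theorem hasTemperateGrowth_wt (ha : 0 < a) (s : ℝ) : (wt (n := n) a s).HasTemperateGrowth := by
  have h : wt (n := n) a s = (fun x : Space n => (1 + ‖x‖ ^ 2) ^ (-s)) ∘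
      (fun x => Real.sqrt a • x) := by
    funext y
    simp [wt, norm_smul, mul_pow, Real.sq_sqrt ha.le]
  rw [h]
  exact (Function.hasTemperateGrowth_one_add_norm_sq_rpow _ _).comp (by fun_prop)

theorem hasRadialGrad_wt (ha : 0 < a) (s : ℝ) :
    HasRadialGrad (wt (n := n) a s) (fun y => -2 * s * a * wt a (s + 1) y) := fun y => by
  have h1 : HasFDerivAt (fun y : Space n => 1 + a * ‖y‖ ^ 2) ((a * 2) • innerSL ℝ y) y :=
    ((hasRadialGrad_norm_sq.const_mul a) y).const_add 1
  refine (h1.rpow_const (p := -s) (Or.inl (wt_base_pos ha y).ne')).congr_fderiv ?_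
  rw [smul_smul]
  congr 1
  simp only [wt, neg_add']
  ring

theorem continuous_wt (ha : 0 < a) (s : ℝ) : Continuous (wt (n := n) a s) :=
  (hasTemperateGrowth_wt ha s).1.continuous

/-- `f(|y|) / |y|`, so that `∇F(|·|)(y) = radK y • y`. -/
noncomputable def radK (a σ : ℝ) : Space n → ℝ := radAvg 0 (wt a σ)

/-- The coefficient in `∇ radK y = -radM y • y`. -/
noncomputable def radM (a σ : ℝ) (y : Space n) : ℝ := 2 * σ * a * radAvg 2 (wt a (σ + 1)) y

/-- The coefficient in `∇ radM y = radM' y • y`. -/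
noncomputable def radM' (a σ : ℝ) (y : Space n) : ℝ :=
  2 * σ * a * radAvg 4 (fun y : Space n => -2 * (σ + 1) * a * wt a (σ + 1 + 1) y) y

theorem hasTemperateGrowth_radK (ha : 0 < a) (σ : ℝ) :
    (radK (n := n) a σ).HasTemperateGrowth :=
  hasTemperateGrowth_radAvg 0 (hasTemperateGrowth_wt ha σ)

theorem hasTemperateGrowth_radM (ha : 0 < a) (σ : ℝ) :
    (radM (n := n) a σ).HasTemperateGrowth :=
  (Function.HasTemperateGrowth.const _).mul
    (hasTemperateGrowth_radAvg 2 (hasTemperateGrowth_wt ha (σ + 1)))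

theorem hasTemperateGrowth_radM' (ha : 0 < a) (σ : ℝ) :
    (radM' (n := n) a σ).HasTemperateGrowth :=
  (Function.HasTemperateGrowth.const _).mul (hasTemperateGrowth_radAvg 4
    ((Function.HasTemperateGrowth.const _).mul (hasTemperateGrowth_wt ha (σ + 1 + 1))))

theorem radAvg_const_mul (j : ℕ) (b : ℝ) (p : Space n → ℝ) (y : Space n) :
    radAvg j (fun y => b * p y) y = b * radAvg j p y := by
  simp only [radAvg, smul_eq_mul]
  rw [← intervalIntegral.integral_const_mul]
  congr 1
  ext t
  ring

theorem hasRadialGrad_radK (ha : 0 < a) (σ : ℝ) :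
    HasRadialGrad (radK (n := n) a σ) (fun y => -radM a σ y) := fun y => by
  have h := ((hasRadialGrad_wt (n := n) ha σ).radAvg (hasTemperateGrowth_wt ha σ) 0) y
  refine h.congr_fderiv ?_
  congr 1
  simp only [radAvg_const_mul, radM]
  ring

theorem hasRadialGrad_radM (ha : 0 < a) (σ : ℝ) :
    HasRadialGrad (radM (n := n) a σ) (radM' a σ) :=
  ((hasRadialGrad_wt (n := n) ha (σ + 1)).radAvg (hasTemperateGrowth_wt ha (σ + 1)) 2).const_mul _

/-- Euler's relation for the average `radK`. The Hessian of F(|·|) is `radK` times the identity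
minus `radM` times y ⊗ y, so this identifies its radial eigenvalue as `wt`, that is g²; the
tangential one is `radK`. -/
theorem radK_eq (ha : 0 < a) (σ : ℝ) (y : Space n) :
    radK a σ y = wt a σ y + radM a σ y * ‖y‖ ^ 2 := by
  have h := (hasRadialGrad_wt (n := n) ha σ).radAvg_euler (hasTemperateGrowth_wt ha σ) 0 y
  rw [radAvg_const_mul] at h
  rw [radK, radM]
  push_cast at h
  linarith

theorem radM'_mul (ha : 0 < a) (σ : ℝ) (y : Space n) :
    radM' a σ y * ‖y‖ ^ 2 = 2 * σ * a * wt a (σ + 1) y - 3 * radM a σ y := by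
  have h := (hasRadialGrad_wt (n := n) ha (σ + 1)).radAvg_euler (hasTemperateGrowth_wt ha (σ + 1))
    2 y
  rw [radM', radM]
  push_cast at h
  linear_combination (2 * σ * a) * h

theorem radM_nonneg (ha : 0 < a) {σ : ℝ} (hσ : 0 ≤ σ) (y : Space n) : 0 ≤ radM a σ y := by
  refine mul_nonneg (by positivity) (intervalIntegral.integral_nonneg zero_le_one fun t ht => ?_)
  exact mul_nonneg (pow_nonneg ht.1 _) (wt_pos ha _ _).le

theorem radK_le_one (ha : 0 < a) {σ : ℝ} (hσ : 0 ≤ σ) (y : Space n) : radK a σ y ≤ 1 := by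
  refine (le_abs_self _).trans (norm_radAvg_le (y := y) (p := wt a σ) 0 (C := 1) fun t _ => ?_)
  rw [Real.norm_of_nonneg (wt_pos ha _ _).le]
  exact wt_le_one ha hσ _

theorem radK_pos (ha : 0 < a) {σ : ℝ} (hσ : 0 ≤ σ) (y : Space n) : 0 < radK a σ y := by
  rw [radK_eq ha]
  have := wt_pos ha σ y
  have := radM_nonneg ha hσ y
  positivity

/-- Only the parameters t ≤ 1/(1+|y|) are kept: there |t y| ≤ 1 and the weight is at least
(1+a)^(-σ). Decay no faster than 1/|y| is what makes the sum over centers diverge. -/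
theorem radK_lower (ha : 0 < a) {σ : ℝ} (hσ : 0 ≤ σ) (y : Space n) :
    (1 + a) ^ (-σ) / (1 + ‖y‖) ≤ radK a σ y := by
  have hy : 0 < 1 + ‖y‖ := by positivity
  set b : ℝ := 1 / (1 + ‖y‖) with hb
  have hb0 : 0 ≤ b := by positivity
  have hb1 : b ≤ 1 := by
    rw [hb, div_le_one hy]
    linarith [norm_nonneg y]
  have hint : ∀ c d : ℝ, IntervalIntegrable (fun t : ℝ => t ^ 0 • wt a σ (t • y)) volume c d :=
    fun c d => intervalIntegrable_radAvg 0 (continuous_wt ha σ) y c d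
  have h1 : ∫ t in (0 : ℝ)..b, (1 + a) ^ (-σ) ≤ ∫ t in (0 : ℝ)..b, t ^ 0 • wt a σ (t • y) := by
    refine intervalIntegral.integral_mono_on hb0 (by simp) (hint 0 b) fun t ht => ?_
    have h2 : ‖t • y‖ ≤ 1 := by
      rw [norm_smul, Real.norm_of_nonneg ht.1]
      calc t * ‖y‖ ≤ b * (1 + ‖y‖) := by
            gcongr
            · exact ht.2
            · linarith
        _ = 1 := by rw [hb]; field_simp
    rw [pow_zero, one_smul, wt]
    refine Real.rpow_le_rpow_of_nonpos (wt_base_pos ha _) ?_ (by linarith)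
    have : ‖t • y‖ ^ 2 ≤ 1 := pow_le_one₀ (norm_nonneg _) h2
    nlinarith
  have h3 : 0 ≤ ∫ t in b..1, t ^ 0 • wt a σ (t • y) :=
    intervalIntegral.integral_nonneg hb1 fun t _ => by simpa using (wt_pos ha σ (t • y)).le
  have h4 := intervalIntegral.integral_add_adjacent_intervals (hint 0 b) (hint b 1)
  rw [intervalIntegral.integral_const] at h1
  have h5 : (1 + a) ^ (-σ) / (1 + ‖y‖) = (b - 0) • (1 + a) ^ (-σ) := by
    rw [hb, smul_eq_mul]; ring
  rw [h5, radK, radAvg]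
  linarith

theorem g_sq (ha : 0 < a) (σ s : ℝ) : g a σ s ^ 2 = (1 + a * s ^ 2) ^ (-σ) := by
  have h : 0 ≤ 1 + a * s ^ 2 := by positivity
  rw [g, div_pow, one_pow, ← Real.rpow_natCast, ← Real.rpow_mul h, Real.rpow_neg h, one_div]
  congr 2
  push_cast
  ring

theorem f_norm (ha : 0 < a) (σ : ℝ) (y : Space n) : f a σ ‖y‖ = ‖y‖ * radK a σ y := by
  have h := intervalIntegral.mul_integral_comp_mul_left (a := 0) (b := 1)
    (f := fun s => g a σ s ^ 2) ‖y‖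
  rw [mul_zero, mul_one] at h
  rw [f, ← h, radK, radAvg]
  congr 1
  refine intervalIntegral.integral_congr fun t _ => ?_
  simp only [g_sq ha, pow_zero, one_smul, wt, norm_smul, mul_pow, Real.norm_eq_abs, sq_abs]
  ring_nf

theorem f_nonneg_smul (ha : 0 < a) (σ : ℝ) {t : ℝ} (ht : 0 ≤ t) (y : Space n) :
    f a σ (‖y‖ * t) = t * ‖y‖ * radK a σ (t • y) := by
  have h := f_norm ha σ (t • y)
  rw [norm_smul, Real.norm_of_nonneg ht] at h
  rw [mul_comm ‖y‖ t, h]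

theorem F_norm (ha : 0 < a) (σ : ℝ) (y : Space n) :
    F a σ ‖y‖ = ‖y‖ ^ 2 * radAvg 1 (radK a σ) y := by
  have h := intervalIntegral.mul_integral_comp_mul_left (a := 0) (b := 1)
    (f := fun s => f a σ s) ‖y‖
  rw [mul_zero, mul_one] at h
  rw [F, ← h, sq, mul_assoc]
  congr 1
  simp only [radAvg]
  rw [← intervalIntegral.integral_const_mul]
  refine intervalIntegral.integral_congr fun t ht => ?_
  rw [Set.uIcc_of_le zero_le_one] at ht
  simp only [f_nonneg_smul ha σ ht.1, pow_one, smul_eq_mul]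
  ring

theorem hasRadialGrad_F_norm (ha : 0 < a) (σ : ℝ) :
    HasRadialGrad (fun y : Space n => F a σ ‖y‖) (radK a σ) := fun y => by
  have hK := hasRadialGrad_radK (n := n) ha σ
  have h1 := hasRadialGrad_norm_sq.mul (hK.radAvg (hasTemperateGrowth_radK ha σ) 1)
  have h2 := hK.radAvg_euler (hasTemperateGrowth_radK ha σ) 1 y
  simp only [F_norm ha σ]
  refine (h1 y).congr_fderiv ?_
  congr 1
  push_cast at h2
  linear_combination h2

theorem HasRadialGrad.hasFDerivAt_sub {p c : Space n → ℝ} (h : HasRadialGrad p c)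
    (b x : Space n) : HasFDerivAt (fun x => p (x - b)) (c (x - b) • innerSL ℝ (x - b)) x :=
  ((h (x - b)).comp x ((hasFDerivAt_id x).sub_const b)).congr_fderiv (by simp)

theorem inner_single_one (y : Space n) (j : Fin n) :
    inner ℝ y (EuclideanSpace.single j (1 : ℝ)) = y j := by
  simp [EuclideanSpace.inner_single_right]

theorem HasRadialGrad.fderiv_sub_single {p c : Space n → ℝ} (h : HasRadialGrad p c)
    (b x : Space n) (j : Fin n) :
    fderiv ℝ (fun x => p (x - b)) x (EuclideanSpace.single j 1) = c (x - b) * (x - b) j := by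
  rw [(h.hasFDerivAt_sub b x).fderiv]
  simp [inner_single_one]

theorem gradFc_eq (ha : 0 < a) (σ : ℝ) (b : Space n) (j : Fin n) :
    gradFc a σ b j = fun x => radK a σ (x - b) * (x - b) j :=
  funext fun x => (hasRadialGrad_F_norm ha σ).fderiv_sub_single b x j

/-- The left-hand side is f(|y|), and g² is integrable on the line because 2σ > 1. -/
theorem exists_norm_mul_radK_le (ha : 0 < a) {σ : ℝ} (hσ : 1 / 2 < σ) :
    ∃ C, 0 ≤ C ∧ ∀ y : Space n, ‖y‖ * radK a σ y ≤ C := by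
  have hi : Integrable (fun s : ℝ => (1 + a * s ^ 2) ^ (-σ)) := by
    have h1 : Integrable (fun x : ℝ => (1 + ‖x‖ ^ 2) ^ (-(2 * σ) / 2)) :=
      integrable_rpow_neg_one_add_norm_sq (by simp; linarith)
    have h2 := h1.comp_mul_left' (Real.sqrt_pos.2 ha).ne'
    refine h2.congr (Filter.Eventually.of_forall fun s => ?_)
    simp only [norm_mul, mul_pow, Real.norm_eq_abs, sq_abs, Real.sq_sqrt ha.le]
    ring_nf
  have hnn : ∀ s : ℝ, 0 ≤ (1 + a * s ^ 2) ^ (-σ) := fun s => by positivity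
  refine ⟨∫ s : ℝ, (1 + a * s ^ 2) ^ (-σ), integral_nonneg hnn, fun y => ?_⟩
  rw [← f_norm ha, f]
  simp only [g_sq ha]
  rw [intervalIntegral.integral_of_le (norm_nonneg y)]
  exact setIntegral_le_integral hi (Filter.Eventually.of_forall hnn)

end RadialCalculus

/-! ### Commutator identities on Schwartz functions. -/

section SchwartzAlgebra

variable {n : ℕ}

/-- The inclusion of the Schwartz space into `L²`. -/
noncomputable def incl (n : ℕ) : 𝓢(Space n, ℂ) →ₗ[ℂ] L2 n :=
  (SchwartzMap.toLpCLM ℂ ℂ 2 (volume : Measure (Space n)) : 𝓢(Space n, ℂ) →L[ℂ] L2 n)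

/-- The partial derivative `∂ⱼ` on Schwartz functions. -/
noncomputable def dS (j : Fin n) : 𝓢(Space n, ℂ) →ₗ[ℂ] 𝓢(Space n, ℂ) :=
  (LineDeriv.lineDerivOpCLM ℂ 𝓢(Space n, ℂ) (EuclideanSpace.single j (1 : ℝ) : Space n) :
    𝓢(Space n, ℂ) →L[ℂ] 𝓢(Space n, ℂ))

/-- Multiplication of Schwartz functions by a real function of temperate growth. -/
noncomputable def mS (G : Space n → ℝ) : 𝓢(Space n, ℂ) →ₗ[ℂ] 𝓢(Space n, ℂ) :=
  (SchwartzMap.smulLeftCLM ℂ (fun x => (G x : ℂ)) : 𝓢(Space n, ℂ) →L[ℂ] 𝓢(Space n, ℂ))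

theorem hasTemperateGrowth_ofReal {G : Space n → ℝ} (hG : G.HasTemperateGrowth) :
    (fun x => (G x : ℂ)).HasTemperateGrowth :=
  Function.HasTemperateGrowth.comp (g := Complex.ofReal)
    Function.Complex.hasTemperateGrowth_ofReal hG

theorem re_inner_comm (f g : L2 n) : (inner ℂ f g).re = (inner ℂ g f).re :=
  inner_re_symm (𝕜 := ℂ) f g

theorem mS_apply {G : Space n → ℝ} (hG : G.HasTemperateGrowth) (u : 𝓢(Space n, ℂ)) (x : Space n) :
    mS G u x = G x * u x := by
  simp [mS, SchwartzMap.smulLeftCLM_apply_apply (hasTemperateGrowth_ofReal hG)]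

theorem dS_apply (j : Fin n) (u : 𝓢(Space n, ℂ)) (x : Space n) :
    dS j u x = fderiv ℝ u x (EuclideanSpace.single j 1) := rfl

theorem inner_incl (f g : 𝓢(Space n, ℂ)) :
    inner ℂ (incl n f) (incl n g) = ∫ x, inner ℂ (f x) (g x) :=
  SchwartzMap.inner_toL2_toL2_eq f g volume

theorem integrable_inner (f g : 𝓢(Space n, ℂ)) : Integrable fun x => inner ℂ (f x) (g x) := by
  have h : Integrable fun x => inner ℂ ((incl n f) x) ((incl n g) x) :=
    L2.integrable_inner (𝕜 := ℂ) (incl n f) (incl n g)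
  refine h.congr ?_
  filter_upwards [f.coeFn_toLp 2 volume, g.coeFn_toLp 2 volume] with x hf hg
  exact congrArg₂ (inner ℂ) hf hg

theorem inner_mS (G : Space n → ℝ) (hG : G.HasTemperateGrowth) (f g : 𝓢(Space n, ℂ)) :
    inner ℂ (incl n (mS G f)) (incl n g) = inner ℂ (incl n f) (incl n (mS G g)) := by
  rw [inner_incl, inner_incl]
  congr 1
  ext x
  simp only [mS_apply hG, RCLike.inner_apply, map_mul, Complex.conj_ofReal]
  ring

theorem inner_dS (j : Fin n) (f g : 𝓢(Space n, ℂ)) :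
    inner ℂ (incl n f) (incl n (dS j g)) = -inner ℂ (incl n (dS j f)) (incl n g) := by
  rw [inner_incl, inner_incl]
  have h := SchwartzMap.integral_bilinear_lineDerivOp_right_eq_neg_left (μ := volume) f g
    ((ContinuousLinearMap.mul ℝ ℂ).comp
      (Complex.conjCLE : ℂ ≃L[ℝ] ℂ).toContinuousLinearMap) (EuclideanSpace.single j (1 : ℝ))
  simp only [RCLike.inner_apply]
  simpa [mul_comm, dS] using h

theorem dS_mS (j : Fin n) {G G' : Space n → ℝ} (hG : G.HasTemperateGrowth)
    (hG' : G'.HasTemperateGrowth) (h : ∀ x, fderiv ℝ G x (EuclideanSpace.single j 1) = G' x)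
    (u : 𝓢(Space n, ℂ)) : dS j (mS G u) = mS G' u + mS G (dS j u) := by
  ext x
  have hd : HasFDerivAt G (fderiv ℝ G x) x := (hG.1.differentiable (by simp) x).hasFDerivAt
  have h2 := (Complex.ofRealCLM.hasFDerivAt.comp x hd).fun_mul u.differentiableAt.hasFDerivAt
  have h1 : (mS G u : Space n → ℂ) = fun x => (G x : ℂ) * u x := funext (mS_apply hG u)
  rw [dS_apply, h1]
  refine (congrArg (fun T : Space n →L[ℝ] ℂ => T (EuclideanSpace.single j 1)) h2.fderiv).trans ?_
  simp [mS_apply hG, mS_apply hG', dS_apply, ← h, mul_comm, add_comm]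

theorem dS_comm (j k : Fin n) (u : 𝓢(Space n, ℂ)) : dS j (dS k u) = dS k (dS j u) := by
  ext x
  have hs : IsSymmSndFDerivAt ℝ u x :=
    ((u.smooth ⊤).contDiffAt).isSymmSndFDerivAt (by simp; exact WithTop.coe_le_coe.2 le_top)
  have key : ∀ i l : Fin n, dS i (dS l u) x = fderiv ℝ (fderiv ℝ u) x
      (EuclideanSpace.single i 1) (EuclideanSpace.single l 1) := by
    intro i l
    have h1 : (dS l u : Space n → ℂ) = fun x => fderiv ℝ u x (EuclideanSpace.single l 1) :=
      funext (dS_apply l u)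
    have hd : DifferentiableAt ℝ (fderiv ℝ u) x :=
      ((u.smooth ⊤).fderiv_right (m := 1) (WithTop.coe_le_coe.2 le_top)).differentiable (by simp) x
    rw [dS_apply, h1, fderiv_clm_apply hd (differentiableAt_const _)]
    simp
  rw [key, key, hs.eq]

theorem re_inner_skew (k : Fin n) {G : Space n → ℝ} (hG : G.HasTemperateGrowth)
    (v : 𝓢(Space n, ℂ)) :
    (inner ℂ (incl n v) (incl n (dS k (mS G v) + mS G (dS k v)))).re = 0 := by
  rw [map_add, inner_add_right, inner_dS, ← inner_mS G hG v, Complex.add_re, Complex.neg_re,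
    re_inner_comm, neg_add_cancel]

/-- This is ∫ G ∂ⱼ|u|² = -∫ (∂ⱼG)|u|², the tool for adding a divergence to a form without changing
its value. -/
theorem two_re_inner_dS (j : Fin n) {G G' : Space n → ℝ} (hG : G.HasTemperateGrowth)
    (hG' : G'.HasTemperateGrowth) (h : ∀ x, fderiv ℝ G x (EuclideanSpace.single j 1) = G' x)
    (u : 𝓢(Space n, ℂ)) :
    2 * (inner ℂ (incl n (dS j u)) (incl n (mS G u))).re =
      -(inner ℂ (incl n u) (incl n (mS G' u))).re := by
  have h1 := re_inner_skew j hG u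
  have h2 := inner_dS j u (mS G u)
  rw [dS_mS j hG hG' h, map_add, map_add, inner_add_right, inner_add_right] at h1
  rw [dS_mS j hG hG' h, map_add, inner_add_right] at h2
  have h3 := congrArg Complex.re h2
  simp only [Complex.add_re, Complex.neg_re] at h1 h3
  linarith

theorem hasTemperateGrowth_pderiv {H : Space n → ℝ} (k : Fin n) (hH : H.HasTemperateGrowth) :
    (fun x => fderiv ℝ H x (EuclideanSpace.single k 1)).HasTemperateGrowth :=
  (ContinuousLinearMap.apply ℝ ℝ
    (EuclideanSpace.single k (1 : ℝ) : Space n)).hasTemperateGrowth.comp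
      (hasTemperateGrowth_fderiv hH)

/-- The commutator of `-Δ` with `∑ₖ (∂ₖ Gₖ + Gₖ ∂ₖ)`. -/
theorem virial (G : Fin n → Space n → ℝ) (G' : Fin n → Fin n → Space n → ℝ)
    (L : Fin n → Space n → ℝ) (B : Space n → ℝ)
    (hG : ∀ k, (G k).HasTemperateGrowth) (hG' : ∀ j k, (G' j k).HasTemperateGrowth)
    (hL : ∀ j, (L j).HasTemperateGrowth) (hB : B.HasTemperateGrowth)
    (hGG' : ∀ j k x, fderiv ℝ (G k) x (EuclideanSpace.single j 1) = G' j k x)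
    (hG'L : ∀ j x, ∑ k, fderiv ℝ (G' j k) x (EuclideanSpace.single k 1) = L j x)
    (hLB : ∀ x, ∑ j, fderiv ℝ (L j) x (EuclideanSpace.single j 1) = -B x)
    (u : 𝓢(Space n, ℂ)) :
    2 * (inner ℂ (incl n (-∑ j, dS j (dS j u)))
        (incl n (∑ k, (dS k (mS (G k) u) + mS (G k) (dS k u))))).re =
      ∑ j, ∑ k, 4 * (inner ℂ (incl n (dS j u)) (incl n (mS (G' j k) (dS k u)))).re +
        (inner ℂ (incl n u) (incl n (mS B u))).re := by
  have hsum : ∀ (H : Fin n → Space n → ℝ) (K : Space n → ℝ), (∀ k, (H k).HasTemperateGrowth) →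
      K.HasTemperateGrowth → (∀ x, ∑ k, H k x = K x) → ∑ k, mS (H k) u = mS K u := by
    intro H K hH hK hHK
    ext x
    simp only [sum_apply, mS_apply (hH _), mS_apply hK, ← hHK, ← Finset.sum_mul]
    push_cast
    rfl
  have hterm : ∀ j, 2 * (inner ℂ (incl n (-dS j (dS j u)))
        (incl n (∑ k, (dS k (mS (G k) u) + mS (G k) (dS k u))))).re =
      ∑ k, 4 * (inner ℂ (incl n (dS j u)) (incl n (mS (G' j k) (dS k u)))).re -
        (inner ℂ (incl n u)
          (incl n (mS (fun x => fderiv ℝ (L j) x (EuclideanSpace.single j 1)) u))).re := by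
    intro j
    -- Move ∂ⱼ to the right through the field operator. The operator itself, now acting on ∂ⱼu, is
    -- skew and has no real part against ∂ⱼu; the commutator is 2 ∑ₖ G'ⱼₖ ∂ₖ plus multiplication by
    -- Lⱼ, and the latter yields ∂ⱼLⱼ after one more integration by parts.
    have h1 : dS j (∑ k, (dS k (mS (G k) u) + mS (G k) (dS k u))) =
        ∑ k, (dS k (mS (G k) (dS j u)) + mS (G k) (dS k (dS j u))) +
          ((2 : ℂ) • ∑ k, mS (G' j k) (dS k u) + mS (L j) u) := by
      rw [← hsum _ (L j) (fun k => hasTemperateGrowth_pderiv k (hG' j k)) (hL j) (hG'L j),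
        map_sum, Finset.smul_sum,
        ← Finset.sum_add_distrib, ← Finset.sum_add_distrib]
      refine Finset.sum_congr rfl fun k _ => ?_
      rw [map_add, dS_comm j k, dS_mS j (hG k) (hG' j k) (hGG' j k), map_add,
        dS_mS k (hG' j k) (hasTemperateGrowth_pderiv k (hG' j k)) (fun _ => rfl),
        dS_mS j (hG k) (hG' j k) (hGG' j k), dS_comm j k, two_smul]
      abel
    rw [map_neg, inner_neg_left, ← inner_dS, h1, map_add, inner_add_right, map_add, inner_add_right,
      map_sum, inner_sum, map_smul, inner_smul_right, map_sum, inner_sum]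
    have h2 := two_re_inner_dS j (hL j) (hasTemperateGrowth_pderiv j (hL j)) (fun _ => rfl) u
    have h3 : (∑ k, inner ℂ (incl n (dS j u))
        (incl n (dS k (mS (G k) (dS j u)) + mS (G k) (dS k (dS j u))))).re = 0 := by
      rw [Complex.re_sum]
      exact Finset.sum_eq_zero fun k _ => re_inner_skew k (hG k) (dS j u)
    rw [← Finset.mul_sum]
    simp only [Complex.add_re, h3, Complex.mul_re, Complex.re_ofNat, Complex.im_ofNat, zero_mul,
      sub_zero, Complex.re_sum] at h2 ⊢
    linarith
  have hfin : mS B u = -∑ j, mS (fun x => fderiv ℝ (L j) x (EuclideanSpace.single j 1)) u := by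
    rw [hsum _ (fun x => -B x) (fun j => hasTemperateGrowth_pderiv j (hL j)) hB.neg hLB]
    ext x
    have h := mS_apply hB.neg u x
    simp only [Pi.neg_apply] at h
    rw [neg_apply, mS_apply hB, show (fun x => -B x) = -B from rfl, h]
    push_cast
    ring
  have hfin' : (inner ℂ (incl n u) (incl n (mS B u))).re = -∑ j, (inner ℂ (incl n u)
      (incl n (mS (fun x => fderiv ℝ (L j) x (EuclideanSpace.single j 1)) u))).re := by
    rw [hfin, map_neg, inner_neg_right, map_sum, inner_sum, Complex.neg_re, Complex.re_sum]
  rw [hfin']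
  generalize incl n (∑ k, (dS k (mS (G k) u) + mS (G k) (dS k u))) = w at hterm ⊢
  rw [← sub_eq_add_neg, ← Finset.sum_sub_distrib, ← Finset.sum_neg_distrib, map_sum, sum_inner,
    Complex.re_sum, Finset.mul_sum]
  exact Finset.sum_congr rfl fun j _ => hterm j

/-- The commutator with a multiplication operator. -/
theorem virial_potential (G : Fin n → Space n → ℝ) (V : Space n → ℝ) (W : Space n → ℝ)
    (hG : ∀ k, (G k).HasTemperateGrowth) (hV : V.HasTemperateGrowth) (hW : W.HasTemperateGrowth)
    (hVW : ∀ x, W x = -2 * ∑ k, fderiv ℝ V x (EuclideanSpace.single k 1) * G k x)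
    (u : 𝓢(Space n, ℂ)) :
    2 * (inner ℂ (incl n (mS V u))
        (incl n (∑ k, (dS k (mS (G k) u) + mS (G k) (dS k u))))).re =
      (inner ℂ (incl n u) (incl n (mS W u))).re := by
  have hpd := fun k : Fin n => hasTemperateGrowth_pderiv k hV
  have hW' : mS W u = (-2 : ℂ) • ∑ k,
      mS (G k) (mS (fun x => fderiv ℝ V x (EuclideanSpace.single k 1)) u) := by
    ext x
    simp only [smul_apply, sum_apply, mS_apply hW, mS_apply (hG _),
      mS_apply (hpd _), hVW]
    push_cast
    rw [smul_eq_mul, mul_assoc, Finset.sum_mul]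
    congr 1
    exact Finset.sum_congr rfl fun k _ => by ring
  rw [hW', map_smul, inner_smul_right, map_sum, map_sum, inner_sum, inner_sum, Complex.mul_re,
    Complex.re_sum, Complex.re_sum, Finset.mul_sum]
  simp only [Complex.neg_re, Complex.re_ofNat, Complex.neg_im, Complex.im_ofNat, neg_zero, zero_mul,
    sub_zero, Finset.mul_sum]
  refine Finset.sum_congr rfl fun k _ => ?_
  have h1 : mS V (mS (G k) u) = mS (G k) (mS V u) := by
    ext x
    simp only [mS_apply hV, mS_apply (hG k)]
    ring
  -- The terms that do not differentiate V cancel by this symmetry.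
  have h2 : (inner ℂ (incl n (mS V (dS k u))) (incl n (mS (G k) u))).re =
      (inner ℂ (incl n (mS V u)) (incl n (mS (G k) (dS k u)))).re := by
    rw [inner_mS V hV, h1, ← inner_mS (G k) (hG k), re_inner_comm]
  rw [map_add, inner_add_right, inner_dS, dS_mS k hV (hpd k) (fun _ => rfl), map_add,
    inner_add_left, ← inner_mS (G k) (hG k), re_inner_comm (incl n u), inner_mS (G k) (hG k) _ u]
  simp only [Complex.add_re, Complex.neg_re, h2]
  ring

end SchwartzAlgebra

/-! ### One center: Hessian, bi-Laplacian and the pointwise Hardy bound. -/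

section SingleCenter

variable {n : ℕ} {a : ℝ}

theorem hasFDerivAt_coord (b : Space n) (j : Fin n) (x : Space n) :
    HasFDerivAt (fun x : Space n => (x - b) j) (EuclideanSpace.proj j : Space n →L[ℝ] ℝ) x :=
  ((EuclideanSpace.proj j : Space n →L[ℝ] ℝ).hasFDerivAt.comp x
    ((hasFDerivAt_id x).sub_const b)).congr_fderiv (by simp)

theorem HasRadialGrad.fderiv_mul_coord {p c : Space n → ℝ} (h : HasRadialGrad p c)
    (b x : Space n) (j k : Fin n) :
    fderiv ℝ (fun x => p (x - b) * (x - b) j) x (EuclideanSpace.single k 1) =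
      c (x - b) * (x - b) k * (x - b) j + p (x - b) * (if j = k then 1 else 0) := by
  rw [((h.hasFDerivAt_sub b x).fun_mul (hasFDerivAt_coord b j x)).fderiv]
  simp [inner_single_one]
  ring

theorem HasRadialGrad.fderiv_mul_coord_mul_coord {p c : Space n → ℝ} (h : HasRadialGrad p c)
    (b x : Space n) (i j k : Fin n) :
    fderiv ℝ (fun x => p (x - b) * (x - b) i * (x - b) j) x (EuclideanSpace.single k 1) =
      c (x - b) * (x - b) k * (x - b) i * (x - b) j +
        p (x - b) * ((if i = k then 1 else 0) * (x - b) j +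
          (x - b) i * (if j = k then 1 else 0)) := by
  rw [(((h.hasFDerivAt_sub b x).fun_mul (hasFDerivAt_coord b i x)).fun_mul
    (hasFDerivAt_coord b j x)).fderiv]
  simp [inner_single_one]
  split_ifs <;> ring

theorem hasTemperateGrowth_sub {p : Space n → ℝ} (hp : p.HasTemperateGrowth) (b : Space n) :
    (fun x => p (x - b)).HasTemperateGrowth :=
  Function.HasTemperateGrowth.comp (g := p) (f := fun x => x - b) hp (by fun_prop)

theorem hasTemperateGrowth_coord (b : Space n) (j : Fin n) :
    (fun x : Space n => (x - b) j).HasTemperateGrowth :=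
  Function.HasTemperateGrowth.comp (g := (EuclideanSpace.proj j : Space n →L[ℝ] ℝ))
    (f := fun x => x - b) (ContinuousLinearMap.hasTemperateGrowth _) (by fun_prop)

theorem sum_coord_sq (y : Space n) : ∑ k, y k * y k = ‖y‖ ^ 2 := by
  rw [EuclideanSpace.real_norm_sq_eq]
  exact Finset.sum_congr rfl fun k _ => (sq (y k)).symm

theorem HasRadialGrad.div_mul_coord {p c : Space n → ℝ} (h : HasRadialGrad p c) (b x : Space n) :
    ∑ k, fderiv ℝ (fun x => p (x - b) * (x - b) k) x (EuclideanSpace.single k 1) =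
      c (x - b) * ‖x - b‖ ^ 2 + n * p (x - b) := by
  simp only [h.fderiv_mul_coord, if_true, mul_one, Finset.sum_add_distrib, mul_assoc,
    ← Finset.mul_sum, sum_coord_sq]
  simp

theorem gradFc_hasTemperateGrowth (ha : 0 < a) (σ : ℝ) (b : Space n) (j : Fin n) :
    (gradFc a σ b j).HasTemperateGrowth := by
  rw [gradFc_eq ha]
  exact (hasTemperateGrowth_sub (hasTemperateGrowth_radK ha σ) b).mul (hasTemperateGrowth_coord b j)

/-- The Hessian `∂ⱼ ∂ₖ F_b`. -/
noncomputable def hessFc (a σ : ℝ) (b : Space n) (j k : Fin n) (x : Space n) : ℝ :=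
  radK a σ (x - b) * (if k = j then 1 else 0) - radM a σ (x - b) * (x - b) j * (x - b) k

theorem hessFc_hasTemperateGrowth (ha : 0 < a) (σ : ℝ) (b : Space n) (j k : Fin n) :
    (hessFc a σ b j k).HasTemperateGrowth :=
  ((hasTemperateGrowth_sub (hasTemperateGrowth_radK ha σ) b).mul (.const _)).sub
    (((hasTemperateGrowth_sub (hasTemperateGrowth_radM ha σ) b).mul
      (hasTemperateGrowth_coord b j)).mul (hasTemperateGrowth_coord b k))

theorem fderiv_gradFc (ha : 0 < a) (σ : ℝ) (b : Space n) (j k : Fin n) (x : Space n) :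
    fderiv ℝ (gradFc a σ b k) x (EuclideanSpace.single j 1) = hessFc a σ b j k x := by
  rw [gradFc_eq ha, (hasRadialGrad_radK ha σ).fderiv_mul_coord, hessFc]
  ring

/-- The coefficient in `∇ Δ F_b = lapCoeff (x - b) • (x - b)`. -/
noncomputable def lapCoeff (a σ : ℝ) (y : Space n) : ℝ :=
  (-((n : ℝ) - 1)) * radM a σ y + (-(2 * σ * a)) * wt a (σ + 1) y

theorem hasRadialGrad_lapCoeff (ha : 0 < a) (σ : ℝ) :
    HasRadialGrad (lapCoeff (n := n) a σ) (fun y => (-((n : ℝ) - 1)) * radM' a σ y +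
      (-(2 * σ * a)) * (-2 * (σ + 1) * a * wt a (σ + 1 + 1) y)) :=
  ((hasRadialGrad_radM ha σ).const_mul _).add ((hasRadialGrad_wt ha (σ + 1)).const_mul _)

theorem hasTemperateGrowth_lapCoeff (ha : 0 < a) (σ : ℝ) :
    (lapCoeff (n := n) a σ).HasTemperateGrowth :=
  ((Function.HasTemperateGrowth.const _).mul (hasTemperateGrowth_radM ha σ)).add
    ((Function.HasTemperateGrowth.const _).mul (hasTemperateGrowth_wt ha (σ + 1)))

/-- The divergence of a row of the Hessian is a component of ∇ΔF_b; `radM'_mul` removes the product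
`radM' * ‖y‖ ^ 2` that appears. -/
theorem div_hessFc (ha : 0 < a) (σ : ℝ) (b : Space n) (j : Fin n) (x : Space n) :
    ∑ k, fderiv ℝ (hessFc a σ b j k) x (EuclideanSpace.single k 1) =
      lapCoeff a σ (x - b) * (x - b) j := by
  have h : ∀ k, fderiv ℝ (hessFc a σ b j k) x (EuclideanSpace.single k 1) =
      -radM a σ (x - b) * ((x - b) k * (if k = j then 1 else 0)) -
        (radM' a σ (x - b) * (x - b) j * ((x - b) k * (x - b) k) +
        (radM a σ (x - b) * ((x - b) k * (if k = j then 1 else 0)) +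
          radM a σ (x - b) * (x - b) j)) := by
    intro k
    have h1 := ((hasRadialGrad_radK (n := n) ha σ).hasFDerivAt_sub b x).mul_const
      (if k = j then (1 : ℝ) else 0)
    have h2 : DifferentiableAt ℝ (fun x => radM a σ (x - b) * (x - b) j * (x - b) k) x :=
      ((((hasRadialGrad_radM ha σ).hasFDerivAt_sub b x).fun_mul (hasFDerivAt_coord b j x)).fun_mul
        (hasFDerivAt_coord b k x)).differentiableAt
    have h3 : fderiv ℝ (hessFc a σ b j k) x = _ := fderiv_fun_sub h1.differentiableAt h2
    rw [h3, h1.fderiv, sub_apply, (hasRadialGrad_radM ha σ).fderiv_mul_coord_mul_coord]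
    by_cases hkj : k = j
    · simp [inner_single_one, hkj]
      ring
    · simp [hkj, Ne.symm hkj]
      ring
  rw [Finset.sum_congr rfl fun k _ => h k]
  simp only [Finset.sum_sub_distrib, Finset.sum_add_distrib, ← Finset.mul_sum, sum_coord_sq]
  simp only [mul_ite, mul_one, mul_zero, Finset.sum_ite_eq', Finset.mem_univ, if_true,
    Finset.sum_const, Finset.card_univ, Fintype.card_fin, nsmul_eq_mul, lapCoeff]
  linear_combination (-(x - b) j) * radM'_mul ha σ (x - b)

/-- The potential `-Δ² F_b` as a function of `x - b`. -/
noncomputable def biLap (a σ : ℝ) (y : Space n) : ℝ :=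
  -(((-((n : ℝ) - 1)) * radM' a σ y +
      (-(2 * σ * a)) * (-2 * (σ + 1) * a * wt a (σ + 1 + 1) y)) * ‖y‖ ^ 2 + n * lapCoeff a σ y)

theorem hasTemperateGrowth_biLap (ha : 0 < a) (σ : ℝ) :
    (biLap (n := n) a σ).HasTemperateGrowth := by
  have h1 := hasTemperateGrowth_radM' (n := n) ha σ
  have h2 := hasTemperateGrowth_wt (n := n) ha (σ + 1 + 1)
  have h3 := hasTemperateGrowth_lapCoeff (n := n) ha σ
  exact (((((Function.HasTemperateGrowth.const _).mul h1).add ((Function.HasTemperateGrowth.const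
    _).mul ((Function.HasTemperateGrowth.const _).mul h2))).mul
    (Function.hasTemperateGrowth_norm_sq _)).add ((Function.HasTemperateGrowth.const _).mul h3)).neg

theorem biLap_eq (ha : 0 < a) (σ : ℝ) (y : Space n) :
    biLap a σ y = ((n : ℝ) - 1) * (n - 3) * radM a σ y + 2 * σ * a * (2 * n - 1) * wt a (σ + 1) y -
      4 * σ * (σ + 1) * a ^ 2 * wt a (σ + 1 + 1) y * ‖y‖ ^ 2 := by
  rw [biLap, lapCoeff]
  linear_combination ((n : ℝ) - 1) * radM'_mul ha σ y

/-- The inverse of the regularized square distance. -/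
noncomputable def invSq (η : ℝ) (y : Space n) : ℝ := (‖y‖ ^ 2 + η)⁻¹

theorem hasTemperateGrowth_invSq {η : ℝ} (hη : 0 < η) : (invSq (n := n) η).HasTemperateGrowth := by
  have h : invSq (n := n) η = fun y => η⁻¹ * wt η⁻¹ 1 y := by
    funext y
    rw [invSq, wt, Real.rpow_neg_one, ← mul_inv]
    congr 1
    field_simp
    ring
  rw [h]
  exact (Function.HasTemperateGrowth.const _).mul (hasTemperateGrowth_wt (inv_pos.2 hη) 1)

theorem hasRadialGrad_invSq {η : ℝ} (hη : 0 < η) :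
    HasRadialGrad (invSq (n := n) η) (fun y => -2 * invSq η y ^ 2) := fun y => by
  have h1 : HasFDerivAt (fun y : Space n => ‖y‖ ^ 2 + η) ((2 : ℝ) • innerSL ℝ y) y :=
    (hasRadialGrad_norm_sq y).add_const η
  have h0 : ‖y‖ ^ 2 + η ≠ 0 := by positivity
  refine ((hasDerivAt_inv h0).comp_hasFDerivAt y h1).congr_fderiv ?_
  rw [smul_smul]
  congr 1
  simp only [invSq, inv_pow]
  ring

/-- The radial coefficient of the comparison field in the Hardy-type inequality. -/
noncomputable def hardyCoeff (a σ η : ℝ) (y : Space n) : ℝ :=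
  ((n : ℝ) - 2) / 2 * (wt a σ y * invSq η y) + (-(σ * a)) * wt a (σ + 1) y

/-- The coefficient of the gradient of `hardyCoeff`. -/
noncomputable def hardyCoeff' (a σ η : ℝ) (y : Space n) : ℝ :=
  ((n : ℝ) - 2) / 2 * (wt a σ y * (-2 * invSq η y ^ 2) +
    invSq η y * (-2 * σ * a * wt a (σ + 1) y)) +
    (-(σ * a)) * (-2 * (σ + 1) * a * wt a (σ + 1 + 1) y)

theorem hasRadialGrad_hardyCoeff (ha : 0 < a) (σ : ℝ) {η : ℝ} (hη : 0 < η) :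
    HasRadialGrad (hardyCoeff (n := n) a σ η) (hardyCoeff' a σ η) :=
  (((hasRadialGrad_wt ha σ).mul (hasRadialGrad_invSq hη)).const_mul _).add
    ((hasRadialGrad_wt ha (σ + 1)).const_mul _)

theorem hasTemperateGrowth_hardyCoeff (ha : 0 < a) (σ : ℝ) {η : ℝ} (hη : 0 < η) :
    (hardyCoeff (n := n) a σ η).HasTemperateGrowth :=
  ((Function.HasTemperateGrowth.const _).mul
    ((hasTemperateGrowth_wt ha σ).mul (hasTemperateGrowth_invSq hη))).add
    ((Function.HasTemperateGrowth.const _).mul (hasTemperateGrowth_wt ha (σ + 1)))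

theorem hardyCoeff_eq (ha : 0 < a) (σ η : ℝ) (y : Space n) :
    hardyCoeff a σ η y = wt a σ y *
      (((n : ℝ) - 2) / 2 * invSq η y - σ * a * (1 + a * ‖y‖ ^ 2)⁻¹) := by
  have h := wt_base_pos ha y
  rw [hardyCoeff, ← wt_succ_mul ha σ y]
  field_simp
  ring

/-- The right-hand side is the weight of |u|² left after completing the square √wt (∇u + ψ y u),
with ψ the factor in `hardyCoeff_eq`. The part -σa/(1+a|y|²) of ψ turns √wt ∇u into ∇(√wt u), and
the part with (n-2)/2 is the classical Hardy field, regularized by η. The `radM` term is nonnegative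
as n ≥ 3 and is dropped. With Z = 1/(1+a|y|²) the Hardy gain (n-2)²/(|y|²+η) must then beat
2σaZ(2Z-1); since a|y|²Z = 1-Z, this costs σ/4, plus 2σaη for the regularization. -/
theorem hardy_potential_ge (ha : 0 < a) {σ η κ : ℝ} (hn : 3 ≤ n) (hσ : 0 < σ) (hη : 0 < η)
    (hκ : σ / 4 + 2 * σ * a * η + κ ≤ ((n : ℝ) - 2) ^ 2) (y : Space n) :
    κ * (wt a σ y * invSq η y) ≤ biLap a σ y +
      4 * (hardyCoeff' a σ η y * ‖y‖ ^ 2 + n * hardyCoeff a σ η y) -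
      4 * wt a σ y * (((n : ℝ) - 2) / 2 * invSq η y - σ * a * (1 + a * ‖y‖ ^ 2)⁻¹) ^ 2 *
        ‖y‖ ^ 2 := by
  have hb := wt_base_pos ha y
  have hn' : (3 : ℝ) ≤ n := by exact_mod_cast hn
  have hm : 0 ≤ ((n : ℝ) - 1) * (n - 3) * radM a σ y :=
    mul_nonneg (mul_nonneg (by linarith) (by linarith)) (radM_nonneg ha hσ.le y)
  have hp := wt_pos ha σ y
  have hr : 0 ≤ ‖y‖ ^ 2 := sq_nonneg _
  rw [biLap_eq ha, hardyCoeff_eq ha, hardyCoeff']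
  have hq1 : wt a (σ + 1) y = wt a σ y * (1 + a * ‖y‖ ^ 2)⁻¹ := by
    rw [← wt_succ_mul ha σ y]; field_simp
  have hq2 : wt a (σ + 1 + 1) y = wt a σ y * (1 + a * ‖y‖ ^ 2)⁻¹ ^ 2 := by
    rw [← wt_succ_mul ha σ y, ← wt_succ_mul ha (σ + 1) y]; field_simp
  have hX1 : invSq η y * ‖y‖ ^ 2 = 1 - η * invSq η y := by
    rw [invSq]; field_simp; ring
  have hX0 : 0 < invSq η y := by rw [invSq]; positivity
  have hZ1 : a * ‖y‖ ^ 2 * (1 + a * ‖y‖ ^ 2)⁻¹ = 1 - (1 + a * ‖y‖ ^ 2)⁻¹ := by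
    field_simp; ring
  have hZ0 : 0 < (1 + a * ‖y‖ ^ 2)⁻¹ := by positivity
  have hZ2 : (1 + a * ‖y‖ ^ 2)⁻¹ ≤ 1 := inv_le_one_of_one_le₀ (by nlinarith)
  rw [hq1, hq2]
  generalize (1 + a * ‖y‖ ^ 2)⁻¹ = Z at *
  generalize invSq η y = X at *
  generalize wt a σ y = p at *
  generalize ‖y‖ ^ 2 = r at *
  have key : 2 * σ * a * Z * (2 * Z - 1) ≤ (((n : ℝ) - 2) ^ 2 - κ) * X := by
    have h1 : a * Z * (2 * Z - 1) = X * ((1 - Z) * (2 * Z - 1) + η * (a * Z * (2 * Z - 1))) := by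
      linear_combination (-(a * Z * (2 * Z - 1))) * hX1 + X * (2 * Z - 1) * hZ1
    -- The maximum is at Z = 3/4. The value 2σ · 1/8 = σ/4 is the origin of the condition σ <
    -- 4(n-2)².
    have h2 : (1 - Z) * (2 * Z - 1) ≤ 1 / 8 := by nlinarith [sq_nonneg (Z - 3 / 4)]
    have h3 : Z * (2 * Z - 1) ≤ 1 := by nlinarith
    have h4 : η * (a * Z * (2 * Z - 1)) ≤ η * a := by
      have := mul_le_mul_of_nonneg_left h3 (mul_pos hη ha).le
      nlinarith
    calc 2 * σ * a * Z * (2 * Z - 1)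
        = X * (2 * σ * ((1 - Z) * (2 * Z - 1) + η * (a * Z * (2 * Z - 1)))) := by
          linear_combination (2 * σ) * h1
      _ ≤ X * (2 * σ * (1 / 8 + η * a)) := by gcongr
      _ ≤ X * (((n : ℝ) - 2) ^ 2 - κ) := by
          gcongr
          linarith
      _ = _ := by ring
  have hrest : 0 ≤ p * (((n : ℝ) - 2) ^ 2 * X + (4 * (n - 2) + (n - 2) ^ 2) * η * X ^ 2 -
      2 * σ * a * Z * (2 * Z - 1) - κ * X) := by
    refine mul_nonneg hp.le ?_
    have : 0 ≤ (4 * ((n : ℝ) - 2) + (n - 2) ^ 2) * η * X ^ 2 := by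
      have : (0 : ℝ) ≤ 4 * (n - 2) + (n - 2) ^ 2 := by nlinarith
      positivity
    linarith
  linear_combination hm + hrest + p * ((4 * ((n : ℝ) - 2) + (n - 2) ^ 2) * X) * hX1 -
    p * 4 * σ * a * Z * hZ1

end SingleCenter

/-! ### Integrated lower bound for the free commutator of one center. -/

section FormBound

variable {n : ℕ} {a : ℝ}

/-- `φ` is integrable with integral `r`. -/
def HasIntegral (φ : Space n → ℝ) (r : ℝ) : Prop := Integrable φ ∧ ∫ x, φ x = r

theorem HasIntegral.add {φ ψ : Space n → ℝ} {r s : ℝ} (h : HasIntegral φ r)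
    (h' : HasIntegral ψ s) : HasIntegral (fun x => φ x + ψ x) (r + s) :=
  ⟨h.1.add h'.1, by rw [integral_add h.1 h'.1, h.2, h'.2]⟩

theorem HasIntegral.const_mul {φ : Space n → ℝ} {r : ℝ} (h : HasIntegral φ r) (c : ℝ) :
    HasIntegral (fun x => c * φ x) (c * r) :=
  ⟨h.1.const_mul c, by rw [integral_const_mul, h.2]⟩

theorem HasIntegral.sum {ι : Type*} (s : Finset ι) {φ : ι → Space n → ℝ} {r : ι → ℝ}
    (h : ∀ i ∈ s, HasIntegral (φ i) (r i)) :
    HasIntegral (fun x => ∑ i ∈ s, φ i x) (∑ i ∈ s, r i) :=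
  ⟨integrable_finsetSum _ fun i hi => (h i hi).1, by
    rw [integral_finsetSum _ fun i hi => (h i hi).1]
    exact Finset.sum_congr rfl fun i hi => (h i hi).2⟩

theorem HasIntegral.mono {φ ψ : Space n → ℝ} {r s : ℝ} (h : HasIntegral φ r)
    (h' : HasIntegral ψ s) (hle : ∀ x, φ x ≤ ψ x) : r ≤ s := by
  rw [← h.2, ← h'.2]
  exact integral_mono h.1 h'.1 hle

theorem hasIntegral_inner_mS {G : Space n → ℝ} (hG : G.HasTemperateGrowth)
    (f g : 𝓢(Space n, ℂ)) :
    HasIntegral (fun x => G x * (inner ℂ (f x) (g x)).re)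
      (inner ℂ (incl n f) (incl n (mS G g))).re := by
  have h : (fun x => G x * (inner ℂ (f x) (g x)).re) =
      fun x => RCLike.re (inner ℂ (f x) (mS G g x)) := by
    funext x
    simp only [mS_apply hG, RCLike.inner_apply, RCLike.re_eq_complex_re]
    rw [mul_assoc, Complex.re_ofReal_mul]
  rw [h, inner_incl, ← RCLike.re_eq_complex_re]
  exact ⟨(integrable_inner f (mS G g)).re, integral_re (integrable_inner f (mS G g))⟩

theorem norm_sq_eq_re_inner (z : ℂ) : ‖z‖ ^ 2 = (inner ℂ z z).re := by
  rw [← inner_self_eq_norm_sq (𝕜 := ℂ), RCLike.re_eq_complex_re]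

/-- The multiplier `∑ₖ (∂ₖ Gₖ + Gₖ ∂ₖ)` on Schwartz functions. -/
noncomputable def fieldOp (G : Fin n → Space n → ℝ) : 𝓢(Space n, ℂ) →ₗ[ℂ] 𝓢(Space n, ℂ) :=
  ∑ k, (dS k ∘ₗ mS (G k) + mS (G k) ∘ₗ dS k)

theorem fieldOp_apply (G : Fin n → Space n → ℝ) (u : 𝓢(Space n, ℂ)) :
    fieldOp G u = ∑ k, (dS k (mS (G k) u) + mS (G k) (dS k u)) := by
  simp [fieldOp, LinearMap.sum_apply]

/-- The operator `-Δ` on Schwartz functions. -/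
noncomputable def negLapS (n : ℕ) : 𝓢(Space n, ℂ) →ₗ[ℂ] 𝓢(Space n, ℂ) :=
  -∑ j, dS j ∘ₗ dS j

theorem negLapS_apply (u : 𝓢(Space n, ℂ)) : negLapS n u = -∑ j, dS j (dS j u) := by
  simp [negLapS, LinearMap.sum_apply]

/-- The weighted energy `∫ p |∇u|² + p |u|² / (|x - b|² + η)`. -/
noncomputable def energy (a σ η : ℝ) (b : Space n) (u : 𝓢(Space n, ℂ)) : ℝ :=
  ∑ k, (inner ℂ (incl n (dS k u)) (incl n (mS (fun x => wt a σ (x - b)) (dS k u)))).re +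
    (inner ℂ (incl n u) (incl n (mS (fun x => wt a σ (x - b) * invSq η (x - b)) u))).re

/-- The form equals `radK` |ξ|² - `radM` |y·ξ|²; Cauchy–Schwarz and `radK_eq` leave `wt` |ξ|². -/
theorem hessian_form_ge (ha : 0 < a) {σ : ℝ} (hσ : 0 ≤ σ) (b x : Space n) (ξ : Fin n → ℂ) :
    wt a σ (x - b) * ∑ k, ‖ξ k‖ ^ 2 ≤
      ∑ j, ∑ k, hessFc a σ b j k x * (inner ℂ (ξ j) (ξ k)).re := by
  set y := x - b with hy
  have h1 : ∑ j, ∑ k, hessFc a σ b j k x * (inner ℂ (ξ j) (ξ k)).re =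
      radK a σ y * ∑ k, ‖ξ k‖ ^ 2 - radM a σ y * ‖∑ k, (y k : ℂ) * ξ k‖ ^ 2 := by
    have h2 : ‖∑ k, (y k : ℂ) * ξ k‖ ^ 2 =
        ∑ j, ∑ k, y j * y k * (inner ℂ (ξ j) (ξ k)).re := by
      rw [← inner_self_eq_norm_sq (𝕜 := ℂ), sum_inner, RCLike.re_eq_complex_re, Complex.re_sum]
      refine Finset.sum_congr rfl fun j _ => ?_
      rw [inner_sum, Complex.re_sum]
      refine Finset.sum_congr rfl fun k _ => ?_
      have : inner ℂ ((y j : ℂ) * ξ j) ((y k : ℂ) * ξ k) =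
          ((y j * y k : ℝ) : ℂ) * inner ℂ (ξ j) (ξ k) := by
        simp only [RCLike.inner_apply, map_mul, Complex.conj_ofReal]
        push_cast
        ring
      rw [this, Complex.re_ofReal_mul]
    rw [h2, Finset.mul_sum, Finset.mul_sum, ← Finset.sum_sub_distrib]
    refine Finset.sum_congr rfl fun j _ => ?_
    simp only [hessFc, sub_mul, Finset.sum_sub_distrib, ← hy]
    congr 1
    · simp only [mul_ite, mul_one, mul_zero, ite_mul, zero_mul, Finset.sum_ite_eq',
        Finset.mem_univ, if_true]
      rw [← inner_self_eq_norm_sq (𝕜 := ℂ), RCLike.re_eq_complex_re]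
    · rw [Finset.mul_sum]
      exact Finset.sum_congr rfl fun k _ => by ring
  have h3 : ‖∑ k, (y k : ℂ) * ξ k‖ ^ 2 ≤ ‖y‖ ^ 2 * ∑ k, ‖ξ k‖ ^ 2 := by
    calc ‖∑ k, (y k : ℂ) * ξ k‖ ^ 2 ≤ (∑ k, |y k| * ‖ξ k‖) ^ 2 := by
          gcongr
          refine (norm_sum_le _ _).trans_eq (Finset.sum_congr rfl fun k _ => ?_)
          rw [norm_mul, Complex.norm_real, Real.norm_eq_abs]
      _ ≤ (∑ k, |y k| ^ 2) * ∑ k, ‖ξ k‖ ^ 2 := Finset.sum_mul_sq_le_sq_mul_sq _ _ _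
      _ = _ := by simp only [sq_abs, EuclideanSpace.real_norm_sq_eq]
  rw [h1, radK_eq ha]
  nlinarith [mul_le_mul_of_nonneg_left h3 (radM_nonneg ha hσ y)]

/-- The first three terms on the right form the square 4p|ξ + ψyz|². Since |ξ|² ≤ 2|ξ + ψyz|² +
2ψ²|y|²|z|², the square together with the reserve κpX|z|² recovers a multiple of the full gradient
term. -/
theorem hardy_square_ge {p X ψ κ C θ : ℝ} (hp : 0 ≤ p) (hX : 0 ≤ X) (hθ0 : 0 ≤ θ) (hθ : θ ≤ 2)
    (hθκ : θ * (2 * C + 1) ≤ κ) (y : Space n) (hC : ψ ^ 2 * ‖y‖ ^ 2 ≤ C * X) (ξ : Fin n → ℂ)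
    (z : ℂ) :
    θ * (p * ∑ k, ‖ξ k‖ ^ 2 + p * X * ‖z‖ ^ 2) ≤
      4 * p * ∑ k, ‖ξ k‖ ^ 2 + 8 * p * ψ * ∑ k, y k * (inner ℂ (ξ k) z).re +
        4 * p * ψ ^ 2 * ‖y‖ ^ 2 * ‖z‖ ^ 2 + κ * (p * X) * ‖z‖ ^ 2 := by
  have h1 : ∑ k, ‖ξ k + (ψ * y k : ℝ) • z‖ ^ 2 = ∑ k, ‖ξ k‖ ^ 2 +
      2 * ψ * ∑ k, y k * (inner ℂ (ξ k) z).re + ψ ^ 2 * ‖y‖ ^ 2 * ‖z‖ ^ 2 := by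
    rw [← sum_coord_sq y, Finset.mul_sum, Finset.mul_sum, Finset.sum_mul,
      ← Finset.sum_add_distrib, ← Finset.sum_add_distrib]
    refine Finset.sum_congr rfl fun k _ => ?_
    rw [norm_add_sq (𝕜 := ℂ), norm_smul, Real.norm_eq_abs, mul_pow, sq_abs,
      inner_smul_right_eq_smul,
      RCLike.re_eq_complex_re, Complex.smul_re, smul_eq_mul]
    ring
  have h2 : ∑ k, ‖ξ k‖ ^ 2 ≤ 2 * ∑ k, ‖ξ k + (ψ * y k : ℝ) • z‖ ^ 2 +
      2 * (ψ ^ 2 * ‖y‖ ^ 2 * ‖z‖ ^ 2) := by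
    rw [← sum_coord_sq y, Finset.mul_sum, Finset.mul_sum, Finset.sum_mul, Finset.mul_sum,
      ← Finset.sum_add_distrib]
    refine Finset.sum_le_sum fun k _ => ?_
    have h3 : ‖ξ k‖ ≤ ‖ξ k + (ψ * y k : ℝ) • z‖ + ‖(ψ * y k : ℝ) • z‖ := by
      simpa using norm_sub_le (ξ k + (ψ * y k : ℝ) • z) ((ψ * y k : ℝ) • z)
    have h4 : ‖(ψ * y k : ℝ) • z‖ ^ 2 = ψ ^ 2 * (y k * y k) * ‖z‖ ^ 2 := by
      rw [norm_smul, Real.norm_eq_abs, mul_pow, sq_abs]; ring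
    rw [← h4]
    nlinarith [norm_nonneg (ξ k), sq_nonneg (‖ξ k + (ψ * y k : ℝ) • z‖ - ‖(ψ * y k : ℝ) • z‖)]
  have h5 : 0 ≤ ∑ k, ‖ξ k + (ψ * y k : ℝ) • z‖ ^ 2 := Finset.sum_nonneg fun _ _ => sq_nonneg _
  have h6 := mul_le_mul_of_nonneg_right hC (sq_nonneg ‖z‖)
  have h7 : 4 * p * ∑ k, ‖ξ k‖ ^ 2 + 8 * p * ψ * ∑ k, y k * (inner ℂ (ξ k) z).re +
        4 * p * ψ ^ 2 * ‖y‖ ^ 2 * ‖z‖ ^ 2 + κ * (p * X) * ‖z‖ ^ 2 =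
      p * (4 * ∑ k, ‖ξ k + (ψ * y k : ℝ) • z‖ ^ 2 + κ * X * ‖z‖ ^ 2) := by
    rw [h1]; ring
  rw [h7, show θ * (p * ∑ k, ‖ξ k‖ ^ 2 + p * X * ‖z‖ ^ 2) =
    p * (θ * (∑ k, ‖ξ k‖ ^ 2 + X * ‖z‖ ^ 2)) by ring]
  refine mul_le_mul_of_nonneg_left ?_ hp
  calc θ * (∑ k, ‖ξ k‖ ^ 2 + X * ‖z‖ ^ 2)
      ≤ θ * ((2 * ∑ k, ‖ξ k + (ψ * y k : ℝ) • z‖ ^ 2 + 2 * (C * X * ‖z‖ ^ 2)) + X * ‖z‖ ^ 2) := by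
        gcongr
        linarith
    _ = (2 * θ) * ∑ k, ‖ξ k + (ψ * y k : ℝ) • z‖ ^ 2 + θ * (2 * C + 1) * (X * ‖z‖ ^ 2) := by ring
    _ ≤ 4 * ∑ k, ‖ξ k + (ψ * y k : ℝ) • z‖ ^ 2 + κ * (X * ‖z‖ ^ 2) := by
        gcongr
        linarith
    _ = _ := by ring

/-- Both parts of the field have square O(1/(|y|²+η)): X²|y|² ≤ X for the Hardy part, and (aZ)²|y|²
= aZ(1-Z) ≤ aZ ≤ (1+aη)X for the other, where X = 1/(|y|²+η) and Z = 1/(1+a|y|²). -/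
theorem hardy_field_sq_le (ha : 0 < a) {σ η : ℝ} (hη : 0 < η) (y : Space n) :
    (((n : ℝ) - 2) / 2 * invSq η y - σ * a * (1 + a * ‖y‖ ^ 2)⁻¹) ^ 2 * ‖y‖ ^ 2 ≤
      (2 * (((n : ℝ) - 2) / 2) ^ 2 + 2 * σ ^ 2 * (1 + a * η)) * invSq η y := by
  have hb := wt_base_pos ha y
  have hd : 0 < ‖y‖ ^ 2 + η := by positivity
  have hX : invSq η y * ‖y‖ ^ 2 = 1 - η * invSq η y := by
    rw [invSq]; field_simp; ring
  have hX0 : 0 < invSq η y := by rw [invSq]; positivity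
  have hZ1 : a * ‖y‖ ^ 2 * (1 + a * ‖y‖ ^ 2)⁻¹ = 1 - (1 + a * ‖y‖ ^ 2)⁻¹ := by
    field_simp; ring
  have hZ0 : 0 < (1 + a * ‖y‖ ^ 2)⁻¹ := by positivity
  have hZX : a * (1 + a * ‖y‖ ^ 2)⁻¹ ≤ (1 + a * η) * invSq η y := by
    rw [invSq, ← div_eq_mul_inv, ← div_eq_mul_inv, div_le_div_iff₀ hb hd]
    nlinarith [mul_nonneg (mul_nonneg ha.le ha.le) (mul_nonneg hη.le (sq_nonneg ‖y‖)),
      sq_nonneg ‖y‖]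
  have hr : 0 ≤ ‖y‖ ^ 2 := sq_nonneg _
  generalize (1 + a * ‖y‖ ^ 2)⁻¹ = Z at *
  generalize invSq η y = X at *
  generalize ‖y‖ ^ 2 = r at *
  generalize ((n : ℝ) - 2) / 2 = α at *
  have h1 : X ^ 2 * r ≤ X := by nlinarith [mul_pos hη hX0]
  have h2 : (a * Z) ^ 2 * r ≤ (1 + a * η) * X := by
    have h3 : (a * Z) ^ 2 * r = a * Z * (1 - Z) := by rw [← hZ1]; ring
    rw [h3]
    nlinarith [mul_pos ha hZ0]
  calc (α * X - σ * a * Z) ^ 2 * r ≤ (2 * (α * X) ^ 2 + 2 * (σ * a * Z) ^ 2) * r := by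
        gcongr
        nlinarith [sq_nonneg (α * X + σ * a * Z)]
    _ = 2 * α ^ 2 * (X ^ 2 * r) + 2 * σ ^ 2 * ((a * Z) ^ 2 * r) := by ring
    _ ≤ 2 * α ^ 2 * X + 2 * σ ^ 2 * ((1 + a * η) * X) := by gcongr
    _ = _ := by ring

theorem hasIntegral_energy (ha : 0 < a) (σ : ℝ) {η : ℝ} (hη : 0 < η) (b : Space n)
    (u : 𝓢(Space n, ℂ)) :
    HasIntegral (fun x => wt a σ (x - b) * ∑ k, ‖dS k u x‖ ^ 2 +
      wt a σ (x - b) * invSq η (x - b) * ‖u x‖ ^ 2) (energy a σ η b u) := by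
  have hp := hasTemperateGrowth_sub (hasTemperateGrowth_wt (n := n) ha σ) b
  have hX := hasTemperateGrowth_sub (hasTemperateGrowth_invSq (n := n) hη) b
  simp only [norm_sq_eq_re_inner, Finset.mul_sum]
  exact (HasIntegral.sum _ fun k _ => hasIntegral_inner_mS hp (dS k u) (dS k u)).add
    (hasIntegral_inner_mS (hp.mul hX) u u)

/-- The commutator `i[-Δ, γ_b]` controls a weighted energy. -/
theorem exists_energy_le (hn : 3 ≤ n) (ha : 0 < a) {σ : ℝ} (hσ : 0 < σ)
    (hσ' : σ < 4 * ((n : ℝ) - 2) ^ 2) :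
    ∃ θ η : ℝ, 0 < θ ∧ 0 < η ∧ ∀ (b : Space n) (u : 𝓢(Space n, ℂ)),
      θ * energy a σ η b u ≤
        2 * (inner ℂ (incl n (negLapS n u)) (incl n (fieldOp (gradFc a σ b) u))).re := by
  -- Half of the gap between (n-2)² and σ/4 is kept as κ; η is then chosen so that its cost 2σaη
  -- uses up the other half.
  set κ : ℝ := (((n : ℝ) - 2) ^ 2 - σ / 4) / 2 with hκ
  have hκ0 : 0 < κ := by rw [hκ]; linarith
  set η : ℝ := κ / (2 * σ * a) with hη
  have hη0 : 0 < η := by positivity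
  have hηκ : σ / 4 + 2 * σ * a * η + κ ≤ ((n : ℝ) - 2) ^ 2 := by
    have : 2 * σ * a * η = κ := by rw [hη]; field_simp
    rw [this, hκ]
    linarith
  set C : ℝ := 2 * (((n : ℝ) - 2) / 2) ^ 2 + 2 * σ ^ 2 * (1 + a * η) with hC
  have hC0 : 0 ≤ C := by positivity
  -- The two entries are the two constraints on θ in `hardy_square_ge`.
  set θ : ℝ := min 2 (κ / (2 * C + 1)) with hθ
  have hθ0 : 0 < θ := lt_min two_pos (by positivity)
  have hθκ : θ * (2 * C + 1) ≤ κ := by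
    calc θ * (2 * C + 1) ≤ κ / (2 * C + 1) * (2 * C + 1) := by
          gcongr
          exact min_le_right _ _
      _ = κ := by field_simp
  refine ⟨θ, η, hθ0, hη0, fun b u => ?_⟩
  have hL : ∀ j, (fun x => lapCoeff a σ (x - b) * (x - b) j).HasTemperateGrowth := fun j =>
    (hasTemperateGrowth_sub (hasTemperateGrowth_lapCoeff (n := n) ha σ) b).mul
      (hasTemperateGrowth_coord b j)
  have hB := hasTemperateGrowth_sub (hasTemperateGrowth_biLap (n := n) ha σ) b
  have hH := hessFc_hasTemperateGrowth (n := n) ha σ b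
  have hY : ∀ j, (fun x => hardyCoeff a σ η (x - b) * (x - b) j).HasTemperateGrowth := fun j =>
    (hasTemperateGrowth_sub (hasTemperateGrowth_hardyCoeff (n := n) ha σ hη0) b).mul
      (hasTemperateGrowth_coord b j)
  have hY' := fun j => hasTemperateGrowth_pderiv j (hY j)
  have hvir := virial (gradFc a σ b) (hessFc a σ b)
    (fun j x => lapCoeff a σ (x - b) * (x - b) j) (fun x => biLap a σ (x - b))
    (gradFc_hasTemperateGrowth ha σ b) hH hL hB (fun j k x => fderiv_gradFc ha σ b j k x)
    (div_hessFc ha σ b)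
    (fun x => by rw [(hasRadialGrad_lapCoeff ha σ).div_mul_coord, biLap, neg_neg]) u
  -- The integral of 4 div(h y |u|²), with y = x - b and h the function `hardyCoeff`, vanishes.
  -- Adding it to the form reduces the estimate to a pointwise inequality of integrands.
  have hdiv : ∑ k, (8 * (inner ℂ (incl n (dS k u))
      (incl n (mS (fun x => hardyCoeff a σ η (x - b) * (x - b) k) u))).re +
      4 * (inner ℂ (incl n u) (incl n (mS (fun x => fderiv ℝ (fun x => hardyCoeff a σ η (x - b) *
        (x - b) k) x (EuclideanSpace.single k 1)) u))).re) = 0 :=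
    Finset.sum_eq_zero fun k _ => by
      linear_combination 4 * two_re_inner_dS k (hY k) (hY' k) (fun _ => rfl) u
  rw [negLapS_apply, fieldOp_apply, hvir, ← add_zero (_ + _), ← hdiv]
  refine ((hasIntegral_energy ha σ hη0 b u).const_mul θ).mono
    (((HasIntegral.sum _ fun j _ => HasIntegral.sum _ fun k _ =>
      (hasIntegral_inner_mS (hH j k) (dS j u) (dS k u)).const_mul 4).add
      (hasIntegral_inner_mS hB u u)).add (HasIntegral.sum _ fun k _ =>
      ((hasIntegral_inner_mS (hY k) (dS k u) u).const_mul 8).add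
        ((hasIntegral_inner_mS (hY' k) u u).const_mul 4))) fun x => ?_
  have hp := (wt_pos ha σ (x - b)).le
  have hX : 0 ≤ invSq η (x - b) := by rw [invSq]; positivity
  have h1 := hessian_form_ge ha hσ.le b x (fun k => dS k u x)
  have h2 := hardy_square_ge hp hX hθ0.le (min_le_left _ _) hθκ (x - b)
    (hardy_field_sq_le (σ := σ) ha hη0 (x - b)) (fun k => dS k u x) (u x)
  have h3 := mul_le_mul_of_nonneg_right (hardy_potential_ge ha hn hσ hη0 hηκ (x - b))
    (sq_nonneg ‖u x‖)
  have h4 : ∑ k, (8 * (hardyCoeff a σ η (x - b) * (x - b) k * (inner ℂ (dS k u x) (u x)).re) +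
      4 * (fderiv ℝ (fun x => hardyCoeff a σ η (x - b) * (x - b) k) x
        (EuclideanSpace.single k 1) * (inner ℂ (u x) (u x)).re)) =
      8 * hardyCoeff a σ η (x - b) * ∑ k, (x - b) k * (inner ℂ (dS k u x) (u x)).re +
      4 * (hardyCoeff' a σ η (x - b) * ‖x - b‖ ^ 2 + n * hardyCoeff a σ η (x - b)) *
        ‖u x‖ ^ 2 := by
    rw [← (hasRadialGrad_hardyCoeff ha σ hη0).div_mul_coord b x, norm_sq_eq_re_inner,
      Finset.sum_add_distrib, Finset.mul_sum, Finset.mul_sum, Finset.sum_mul]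
    congr 1
    · exact Finset.sum_congr rfl fun k _ => by ring
    · exact Finset.sum_congr rfl fun k _ => by ring
  have h5 : ∑ j, ∑ k, 4 * (hessFc a σ b j k x * (inner ℂ (dS j u x) (dS k u x)).re) =
      4 * ∑ j, ∑ k, hessFc a σ b j k x * (inner ℂ (dS j u x) (dS k u x)).re := by
    simp only [Finset.mul_sum]
  rw [h4, h5, ← norm_sq_eq_re_inner]
  rw [hardyCoeff_eq ha] at h3 ⊢
  linarith

end FormBound

/-! ### The gradient field of the lattice of centers and its pairing with x - b_j. -/

section LatticeField

variable {n : ℕ} {a : ℝ}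

theorem f_mono (ha : 0 < a) (σ : ℝ) {r s : ℝ} (hr : 0 ≤ r) (hrs : r ≤ s) : f a σ r ≤ f a σ s := by
  have hc : Continuous fun s : ℝ => g a σ s ^ 2 := by
    simp only [g_sq ha]
    refine Continuous.rpow_const (by fun_prop) fun s => Or.inl ?_
    positivity
  exact intervalIntegral.integral_mono_interval le_rfl hr hrs
    (Filter.Eventually.of_forall fun s => sq_nonneg _) (hc.intervalIntegrable _ _)

theorem radK_eq_of_norm_eq {y z : Space n} (σ : ℝ) (h : ‖y‖ = ‖z‖) : radK a σ y = radK a σ z := by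
  simp only [radK, radAvg, wt, norm_smul, h]

/-- Gradient monotonicity of the convex function F(|·|): by Cauchy–Schwarz it reduces to f being
nondecreasing. -/
theorem monotone_radK_smul (ha : 0 < a) {σ : ℝ} (hσ : 0 ≤ σ) (z w : Space n) :
    0 ≤ inner ℝ (radK a σ z • z - radK a σ w • w) (z - w) := by
  have hz := (radK_pos ha hσ z).le
  have hw := (radK_pos ha hσ w).le
  have h1 : inner ℝ (radK a σ z • z - radK a σ w • w) (z - w) =
      radK a σ z * ‖z‖ ^ 2 + radK a σ w * ‖w‖ ^ 2 - (radK a σ z + radK a σ w) * inner ℝ z w := by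
    simp only [inner_sub_left, inner_sub_right, real_inner_smul_left, real_inner_self_eq_norm_sq,
      real_inner_comm w z]
    ring
  have h2 : 0 ≤ (‖z‖ * radK a σ z - ‖w‖ * radK a σ w) * (‖z‖ - ‖w‖) := by
    rw [← f_norm ha, ← f_norm ha]
    rcases le_total ‖z‖ ‖w‖ with h | h
    · exact mul_nonneg_of_nonpos_of_nonpos
        (sub_nonpos.2 (f_mono ha σ (norm_nonneg _) h)) (sub_nonpos.2 h)
    · exact mul_nonneg (sub_nonneg.2 (f_mono ha σ (norm_nonneg _) h)) (sub_nonneg.2 h)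
  rw [h1]
  nlinarith [mul_le_mul_of_nonneg_left (real_inner_le_norm z w) (add_nonneg hz hw)]

/-- The symmetric sum of the fields of two centers `±t e` dominates its transversal part. -/
theorem pair_field_ge (ha : 0 < a) {σ : ℝ} (hσ : 0 ≤ σ) {e : Space n} (he : ‖e‖ = 1) (y : Space n)
    (t : ℝ) :
    (‖y‖ ^ 2 - inner ℝ y e ^ 2) * (radK a σ (y - t • e) + radK a σ (y + t • e)) ≤
      radK a σ (y - t • e) * inner ℝ y (y - t • e) +
        radK a σ (y + t • e) * inner ℝ y (y + t • e) := by
  set s : ℝ := inner ℝ y e with hs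
  have hee : inner ℝ e e = (1 : ℝ) := by rw [real_inner_self_eq_norm_sq, he, one_pow]
  have hes : inner ℝ e y = s := real_inner_comm _ _
  -- The mirror image of y - te in the hyperplane orthogonal to e. It has the same `radK`, and it
  -- differs from y + te by 2s e, so monotonicity of the field between these two points bounds
  -- exactly the longitudinal part of the sum.
  set w : Space n := y + (t - 2 * s) • e with hw
  have hnorm : ‖w‖ = ‖y - t • e‖ := by
    rw [← sq_eq_sq₀ (norm_nonneg _) (norm_nonneg _), ← real_inner_self_eq_norm_sq,
      ← real_inner_self_eq_norm_sq, hw]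
    simp only [inner_add_left, inner_add_right, inner_sub_left, inner_sub_right,
      real_inner_smul_left, real_inner_smul_right, hee, hes, ← hs]
    ring
  have h := monotone_radK_smul ha hσ (y + t • e) w
  rw [radK_eq_of_norm_eq σ hnorm, hw] at h
  have e1 : y + t • e - (y + (t - 2 * s) • e) = (2 * s) • e := by
    rw [add_sub_add_left_eq_sub, ← sub_smul]; congr 1; ring
  rw [e1] at h
  simp only [inner_add_left, inner_add_right, inner_sub_left, inner_sub_right,
    real_inner_smul_left, real_inner_smul_right, hee, ← hs, real_inner_self_eq_norm_sq] at h ⊢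
  nlinarith

/-- The vector field `∇ ∑_{|k| ≤ N} F_{b_k}`. -/
noncomputable def latticeField (a σ : ℝ) (N : ℕ) (x : Space n) : Space n :=
  ∑ l ∈ Finset.Icc (-(N : ℤ)) N, radK a σ (x - latticePoint n l) • (x - latticePoint n l)

theorem latticePoint_eq (hn : 0 < n) (j : ℤ) :
    latticePoint n j = (j : ℝ) • (EuclideanSpace.single (⟨0, hn⟩ : Fin n) (1 : ℝ) : Space n) := by
  ext i
  simp [latticePoint, Fin.ext_iff]

/-- Adding the reflected sum t ↦ -t doubles the total and makes every summand a pair, to which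
`pair_field_ge` and `radK_lower` apply; the indices 0 ≤ t < L already give the harmonic sum. -/
theorem window_field_ge (ha : 0 < a) {σ : ℝ} (hσ : 0 ≤ σ) {e : Space n} (he : ‖e‖ = 1)
    (L : ℕ) {R : ℝ} {y : Space n} (hy : ‖y‖ ≤ R) :
    (‖y‖ ^ 2 - inner ℝ y e ^ 2) * ((1 + a) ^ (-σ) * ∑ i ∈ Finset.range L, 1 / (1 + R + (i : ℝ))) ≤
      ∑ t ∈ Finset.Icc (-(L : ℤ)) L,
        radK a σ (y - (t : ℝ) • e) * inner ℝ y (y - (t : ℝ) • e) := by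
  set T : ℤ → ℝ := fun t => radK a σ (y - (t : ℝ) • e) * inner ℝ y (y - (t : ℝ) • e) with hT
  have hperp : 0 ≤ ‖y‖ ^ 2 - inner ℝ y e ^ 2 := by
    have h1 := abs_real_inner_le_norm y e
    rw [he, mul_one] at h1
    have h2 := sq_le_sq' (by linarith [neg_abs_le ‖y‖, abs_nonneg (inner ℝ y e)]) (h1.trans
      (le_refl _))
    rw [sq_abs] at h2
    linarith
  have hR : 0 ≤ R := (norm_nonneg y).trans hy
  have ha' : 0 < (1 + a) ^ (-σ) := by positivity
  have hK : ∀ t : ℤ, (1 + a) ^ (-σ) * (1 / (1 + R + |(t : ℝ)|)) ≤ radK a σ (y - (t : ℝ) • e) := by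
    intro t
    refine le_trans ?_ (radK_lower ha hσ _)
    rw [mul_one_div]
    refine div_le_div_of_nonneg_left ha'.le (by positivity) ?_
    calc 1 + ‖y - (t : ℝ) • e‖ ≤ 1 + (‖y‖ + ‖(t : ℝ) • e‖) := by gcongr; exact norm_sub_le _ _
      _ ≤ 1 + R + |(t : ℝ)| := by
          rw [norm_smul, he, mul_one, Real.norm_eq_abs]
          linarith
  have hpair : ∀ t : ℤ, (‖y‖ ^ 2 - inner ℝ y e ^ 2) *
      (2 * ((1 + a) ^ (-σ) * (1 / (1 + R + |(t : ℝ)|)))) ≤ T t + T (-t) := by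
    intro t
    have h1 := pair_field_ge ha hσ he y t
    have h2 := hK t
    have h3 := hK (-t)
    simp only [Int.cast_neg, abs_neg, neg_smul, sub_neg_eq_add] at h3
    simp only [hT, Int.cast_neg, neg_smul, sub_neg_eq_add]
    refine le_trans (mul_le_mul_of_nonneg_left ?_ hperp) h1
    linarith
  have hrefl : ∑ t ∈ Finset.Icc (-(L : ℤ)) L, T (-t) = ∑ t ∈ Finset.Icc (-(L : ℤ)) L, T t := by
    refine Finset.sum_nbij' (fun t => -t) (fun t => -t) ?_ ?_ ?_ ?_ ?_ <;>
      simp +contextual [Finset.mem_Icc] <;> omega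
  have hsum := Finset.sum_le_sum fun t (_ : t ∈ Finset.Icc (-(L : ℤ)) L) => hpair t
  rw [Finset.sum_add_distrib, hrefl, ← Finset.mul_sum, ← Finset.mul_sum, ← Finset.mul_sum] at hsum
  have hsub : ∑ i ∈ Finset.range L, 1 / (1 + R + (i : ℝ)) ≤
      ∑ t ∈ Finset.Icc (-(L : ℤ)) L, 1 / (1 + R + |(t : ℝ)|) := by
    have h1 : ∑ i ∈ Finset.range L, 1 / (1 + R + (i : ℝ)) =
        ∑ t ∈ (Finset.range L).map Nat.castEmbedding, 1 / (1 + R + |((t : ℤ) : ℝ)|) := by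
      rw [Finset.sum_map]
      refine Finset.sum_congr rfl fun i _ => ?_
      simp
    rw [h1]
    refine Finset.sum_le_sum_of_subset_of_nonneg ?_ fun t _ _ => by positivity
    intro t ht
    simp only [Finset.mem_map, Finset.mem_range, Nat.castEmbedding_apply] at ht
    obtain ⟨i, hi, rfl⟩ := ht
    rw [Finset.mem_Icc]
    omega
  have := mul_le_mul_of_nonneg_left (mul_le_mul_of_nonneg_left hsub ha'.le) hperp
  linarith

/-- Seen from b_j, the centers occupy [-N-j, N-j], which contains the symmetric window of radius
N-M. The remaining 2M centers contribute at least -C|x-b_j| each, whatever N is. -/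
theorem latticeField_ge (hn : 0 < n) (ha : 0 < a) {σ : ℝ} (hσ : 0 ≤ σ) {C : ℝ}
    (hC : ∀ y : Space n, ‖y‖ * radK a σ y ≤ C) {M N : ℕ} (hMN : M ≤ N) {j : ℤ}
    (hj : j ∈ Finset.Icc (-(M : ℤ)) M) {R : ℝ} {x : Space n} (hx : ‖x - latticePoint n j‖ ≤ R) :
    (‖x - latticePoint n j‖ ^ 2 - (x - latticePoint n j) ⟨0, hn⟩ ^ 2) *
        ((1 + a) ^ (-σ) * ∑ i ∈ Finset.range (N - M), 1 / (1 + R + (i : ℝ))) -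
      2 * M * C * ‖x - latticePoint n j‖ ≤
      inner ℝ (x - latticePoint n j) (latticeField a σ N x) := by
  set y := x - latticePoint n j with hy
  set e : Space n := EuclideanSpace.single (⟨0, hn⟩ : Fin n) (1 : ℝ) with he
  have he1 : ‖e‖ = 1 := by simp [he]
  set T : ℤ → ℝ := fun t => radK a σ (y - (t : ℝ) • e) * inner ℝ y (y - (t : ℝ) • e) with hT
  rw [Finset.mem_Icc] at hj
  have h1 : inner ℝ y (latticeField a σ N x) =
      ∑ t ∈ Finset.Icc (-(N : ℤ) - j) (N - j), T t := by
    rw [latticeField, inner_sum]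
    refine Finset.sum_nbij' (fun l => l - j) (fun t => t + j) ?_ ?_ ?_ ?_ ?_
    · intro l hl; rw [Finset.mem_Icc] at hl ⊢; omega
    · intro l hl; rw [Finset.mem_Icc] at hl ⊢; omega
    · intro l _; ring
    · intro l _; ring
    · intro l _
      have : x - latticePoint n l = y - ((l - j : ℤ) : ℝ) • e := by
        rw [hy, latticePoint_eq hn, latticePoint_eq hn, ← he]
        push_cast
        rw [sub_smul]
        abel
      simp only [hT, real_inner_smul_right, this]
  have hsub : Finset.Icc (-((N - M : ℕ) : ℤ)) ((N - M : ℕ) : ℤ) ⊆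
      Finset.Icc (-(N : ℤ) - j) (N - j) := by
    intro t ht
    rw [Finset.mem_Icc] at ht ⊢
    omega
  have hwin := window_field_ge ha hσ he1 (N - M) hx
  have hrest : -(2 * M * C * ‖y‖) ≤ ∑ t ∈ Finset.Icc (-(N : ℤ) - j) (N - j) \
      Finset.Icc (-((N - M : ℕ) : ℤ)) ((N - M : ℕ) : ℤ), T t := by
    have hcard : (Finset.Icc (-(N : ℤ) - j) (N - j) \
        Finset.Icc (-((N - M : ℕ) : ℤ)) ((N - M : ℕ) : ℤ)).card = 2 * M := by
      rw [Finset.card_sdiff_of_subset hsub, Int.card_Icc, Int.card_Icc]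
      omega
    have hT' : ∀ t : ℤ, -(C * ‖y‖) ≤ T t := by
      intro t
      have h2 := hC (y - (t : ℝ) • e)
      have h3 := abs_real_inner_le_norm y (y - (t : ℝ) • e)
      have h4 := (radK_pos ha hσ (y - (t : ℝ) • e)).le
      have h5 := neg_le_of_abs_le h3
      have h6 := mul_le_mul_of_nonneg_left h5 h4
      have h7 := mul_le_mul_of_nonneg_left h2 (norm_nonneg y)
      simp only [hT]
      linarith
    have := Finset.card_nsmul_le_sum _ T _ (fun t (_ : t ∈ Finset.Icc (-(N : ℤ) - j) (N - j) \
      Finset.Icc (-((N - M : ℕ) : ℤ)) ((N - M : ℕ) : ℤ)) => hT' t)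
    rw [hcard, nsmul_eq_mul] at this
    push_cast at this
    linarith
  rw [h1, ← Finset.sum_sdiff hsub]
  rw [inner_single_one] at hwin
  linarith

theorem tendsto_shifted_harmonic {R : ℝ} (hR : 0 ≤ R) :
    Filter.Tendsto (fun L : ℕ => ∑ i ∈ Finset.range L, 1 / (1 + R + (i : ℝ))) Filter.atTop
      Filter.atTop := by
  have h1 : Filter.Tendsto (fun L : ℕ => (1 + R)⁻¹ * ∑ i ∈ Finset.range L, 1 / ((i : ℝ) + 1))
      Filter.atTop Filter.atTop :=
    Real.tendsto_sum_range_one_div_nat_succ_atTop.const_mul_atTop (by positivity)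
  refine Filter.tendsto_atTop_mono (fun L => ?_) h1
  rw [Finset.mul_sum]
  refine Finset.sum_le_sum fun i _ => ?_
  rw [← one_div, one_div_mul_one_div]
  gcongr
  nlinarith [mul_nonneg hR (Nat.cast_nonneg (α := ℝ) i)]

/-- The center is a maximum, so the derivative vanishes there; elsewhere it is the nonpositive
radial derivative along (x-b_j)/|x-b_j|. -/
theorem fderiv_bump (hn : 0 < n) {v : ℝ → ℝ} {j : ℤ}
    (hs : ContDiff ℝ ((⊤ : ℕ∞) : WithTop ℕ∞) (bump n v j)) (hv : AntitoneOn v (Set.Ici 0))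
    (x : Space n) :
    ∃ w : ℝ, 0 ≤ w ∧ fderiv ℝ (bump n v j) x = (-w) • innerSL ℝ (x - latticePoint n j) := by
  set b := latticePoint n j with hb
  by_cases hx : x = b
  · refine ⟨0, le_rfl, ?_⟩
    rw [neg_zero, zero_smul]
    refine IsLocalMax.fderiv_eq_zero (Filter.Eventually.of_forall fun z => ?_)
    simp only [bump, hx, ← hb, sub_self, norm_zero]
    exact hv (Set.mem_Ici.2 le_rfl) (Set.mem_Ici.2 (norm_nonneg _)) (norm_nonneg _)
  · set y := x - b with hy
    have hy0 : y ≠ 0 := sub_ne_zero.2 hx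
    have hr : 0 < ‖y‖ := norm_pos_iff.2 hy0
    set e : Space n := EuclideanSpace.single (⟨0, hn⟩ : Fin n) (1 : ℝ) with he
    -- The profile v is controlled only on [0, ∞); its differentiability at positive radii is read
    -- off from the bump on a line through the center.
    set φ : ℝ → ℝ := fun r => bump n v j (b + r • e) with hφ
    have hφv : ∀ r, 0 ≤ r → φ r = v r := fun r hr => by
      simp [hφ, bump, ← hb, he, norm_smul, abs_of_nonneg hr]
    have hφd : DifferentiableAt ℝ φ ‖y‖ :=
      ((hs.comp (by fun_prop : ContDiff ℝ _ fun r : ℝ => b + r • e)).differentiable (by simp)) _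
    have hanti : AntitoneOn φ (Set.Ici 0) := fun r hr s hs h => by
      rw [hφv r hr, hφv s hs]
      exact hv hr hs h
    have hneg : deriv φ ‖y‖ ≤ 0 := by
      have h1 := hanti.derivWithin_nonpos (x := ‖y‖)
      rwa [derivWithin_of_mem_nhds (Ici_mem_nhds hr)] at h1
    have hcomp : bump n v j = fun z => φ (Real.sqrt (‖z - b‖ ^ 2)) := by
      funext z
      rw [Real.sqrt_sq (norm_nonneg _), hφv _ (norm_nonneg _), bump]
    have hsq := (hasRadialGrad_norm_sq.hasFDerivAt_sub b x).sqrt (by positivity)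
    have hsqy : Real.sqrt (‖x - b‖ ^ 2) = ‖y‖ := Real.sqrt_sq (norm_nonneg _)
    have hfd := (hsqy ▸ hφd).hasDerivAt.comp_hasFDerivAt x hsq
    refine ⟨-deriv φ ‖y‖ / ‖y‖, by apply div_nonneg <;> linarith, ?_⟩
    rw [hcomp]
    refine hfd.fderiv.trans ?_
    rw [hsqy, smul_smul, smul_smul]
    congr 1
    field_simp

end LatticeField

/-! ### Negativity of the potential commutator is confined to a slab; mass of slabs. -/

section PotentialBound

variable {n : ℕ} {a : ℝ}

/-- The order of quantifiers is essential: R and C precede δ, and only the threshold for N depends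
on δ. This allows δ to be chosen later in terms of C. -/
theorem exists_potential_bound (hn : 2 ≤ n) (ha : 0 < a) {σ : ℝ} (hσ : 1 / 2 < σ) (M : ℕ)
    (V : ℤ → ℝ → ℝ)
    (hV_smooth : ∀ j ∈ Finset.Icc (-(M : ℤ)) M,
      ContDiff ℝ ((⊤ : ℕ∞) : WithTop ℕ∞) (bump n (V j) j))
    (hV_supp : ∀ j ∈ Finset.Icc (-(M : ℤ)) M, HasCompactSupport (bump n (V j) j))
    (hV_decr : ∀ j ∈ Finset.Icc (-(M : ℤ)) M, AntitoneOn (V j) (Set.Ici 0)) :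
    ∃ R C : ℝ, 0 ≤ C ∧ ∀ δ : ℝ, 0 < δ → ∃ N₀ : ℕ, M ≤ N₀ ∧ ∀ N : ℕ, N₀ ≤ N → ∀ x : Space n,
      -(if ‖x‖ ≤ R ∧ |x ⟨1, hn⟩| < δ then C else 0) ≤
        -2 * fderiv ℝ (latticePotential n M V) x (latticeField a σ N x) := by
  have hn0 : 0 < n := by omega
  have hσ0 : 0 ≤ σ := by linarith
  obtain ⟨Cf, hCf0, hCf⟩ := exists_norm_mul_radK_le (n := n) ha hσ
  have hsupp : ∃ R : ℝ, ∀ j ∈ Finset.Icc (-(M : ℤ)) M, ∀ x : Space n, R < ‖x‖ →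
      fderiv ℝ (bump n (V j) j) x = 0 := by
    have hK : IsCompact (⋃ j ∈ Finset.Icc (-(M : ℤ)) M, tsupport (bump n (V j) j)) :=
      Finset.isCompact_biUnion _ fun j hj => hV_supp j hj
    obtain ⟨R, hR⟩ := hK.isBounded.exists_norm_le
    refine ⟨R, fun j hj x hx => ?_⟩
    have h1 : x ∉ tsupport (bump n (V j) j) := fun h =>
      absurd (hR x (Set.mem_biUnion hj h)) (not_le.2 hx)
    exact Function.notMem_support.1 fun h => h1 (support_fderiv_subset ℝ h)
  obtain ⟨R, hR⟩ := hsupp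
  have hbd : ∃ D : ℝ, 0 ≤ D ∧ ∀ j ∈ Finset.Icc (-(M : ℤ)) M, ∀ x : Space n,
      ‖fderiv ℝ (bump n (V j) j) x‖ ≤ D := by
    have h1 : ∀ j ∈ Finset.Icc (-(M : ℤ)) M, ∃ D : ℝ, ∀ x : Space n,
        ‖fderiv ℝ (bump n (V j) j) x‖ ≤ D := fun j hj =>
      ((hV_supp j hj).fderiv ℝ).exists_bound_of_continuous
        ((hV_smooth j hj).continuous_fderiv (by simp))
    choose! D hD using h1
    refine ⟨∑ j ∈ Finset.Icc (-(M : ℤ)) M, |D j|, Finset.sum_nonneg fun _ _ => abs_nonneg _,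
      fun j hj x => (hD j hj x).trans ((le_abs_self _).trans ?_)⟩
    exact Finset.single_le_sum (f := fun j => |D j|) (fun _ _ => abs_nonneg _) hj
  obtain ⟨D, hD0, hD⟩ := hbd
  set R' : ℝ := |R| + M with hR'
  have hR'0 : 0 ≤ R' := by positivity
  -- If ∇V_j = -w y with y = x - b_j, the loss is at most 2w · 2M Cf |y|, and w|y| = |∇V_j| ≤ D.
  refine ⟨R, ∑ j ∈ Finset.Icc (-(M : ℤ)) M, 4 * M * Cf * D,
    Finset.sum_nonneg fun _ _ => by positivity, fun δ hδ => ?_⟩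
  -- Outside the slab the transversal distance squared is at least δ², so the divergent harmonic sum
  -- eventually beats the loss from the unpaired centers.
  have hlim := ((tendsto_shifted_harmonic hR'0).const_mul_atTop
    (by positivity : 0 < δ ^ 2 * (1 + a) ^ (-σ))).eventually_ge_atTop (2 * M * Cf * R')
  obtain ⟨L₀, hL₀⟩ := Filter.eventually_atTop.1 hlim
  refine ⟨M + L₀, by omega, fun N hN x => ?_⟩
  have hdiff : ∀ j ∈ Finset.Icc (-(M : ℤ)) M, DifferentiableAt ℝ (bump n (V j) j) x :=
    fun j hj => (hV_smooth j hj).differentiable (by simp) x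
  have hfd : fderiv ℝ (latticePotential n M V) x =
      ∑ j ∈ Finset.Icc (-(M : ℤ)) M, fderiv ℝ (bump n (V j) j) x := fderiv_fun_sum hdiff
  rw [hfd, sum_apply, Finset.mul_sum]
  have hterm : ∀ j ∈ Finset.Icc (-(M : ℤ)) M,
      -(if ‖x‖ ≤ R ∧ |x ⟨1, hn⟩| < δ then 4 * M * Cf * D else 0) ≤
        -2 * fderiv ℝ (bump n (V j) j) x (latticeField a σ N x) := by
    intro j hj
    by_cases hxR : ‖x‖ ≤ R
    · obtain ⟨w, hw, hfw⟩ := fderiv_bump hn0 (hV_smooth j hj) (hV_decr j hj) x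
      have hDx := hD j hj x
      rw [hfw] at hDx ⊢
      set y := x - latticePoint n j with hy
      rw [norm_smul, innerSL_apply_norm, norm_neg, Real.norm_of_nonneg hw] at hDx
      have hjM : |(j : ℝ)| ≤ M := by
        rw [Finset.mem_Icc] at hj
        exact abs_le.2 ⟨by exact_mod_cast hj.1, by exact_mod_cast hj.2⟩
      have hyR : ‖y‖ ≤ R' := by
        have h1 := norm_sub_le x (latticePoint n j)
        rw [latticePoint_eq hn0, norm_smul] at h1
        simp only [PiLp.norm_single, norm_one, mul_one, Real.norm_eq_abs] at h1
        rw [hy, latticePoint_eq hn0]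
        linarith [le_abs_self R]
      have hge := latticeField_ge hn0 ha hσ0 hCf (by omega : M ≤ N) hj hyR
      rw [← hy] at hge
      -- All lattice points have vanishing coordinate 1, so one slab serves every bump.
      have hx1 : x ⟨1, hn⟩ ^ 2 ≤ ‖y‖ ^ 2 - y ⟨0, hn0⟩ ^ 2 := by
        have h1 : y ⟨1, hn⟩ = x ⟨1, hn⟩ := by simp [hy, latticePoint]
        rw [EuclideanSpace.real_norm_sq_eq, ← h1, le_sub_iff_add_le]
        have h2 := Finset.sum_le_sum_of_subset_of_nonneg
          (Finset.subset_univ ({⟨1, hn⟩, ⟨0, hn0⟩} : Finset (Fin n)))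
          (fun i _ _ => sq_nonneg (y i))
        rwa [Finset.sum_pair (by simp)] at h2
      set Sg := ∑ i ∈ Finset.range (N - M), 1 / (1 + R' + (i : ℝ)) with hSg
      have hSg0 : 0 ≤ Sg := Finset.sum_nonneg fun _ _ => by positivity
      have ha' : 0 < (1 + a) ^ (-σ) := by positivity
      have hval : -2 * (((-w) • innerSL ℝ y) (latticeField a σ N x)) =
          2 * w * inner ℝ y (latticeField a σ N x) := by
        simp
        ring
      rw [hval]
      by_cases hxd : |x ⟨1, hn⟩| < δ
      · rw [if_pos ⟨hxR, hxd⟩]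
        have h1 : -(2 * M * Cf * ‖y‖) ≤ inner ℝ y (latticeField a σ N x) := by
          have : 0 ≤ (‖y‖ ^ 2 - y ⟨0, hn0⟩ ^ 2) * ((1 + a) ^ (-σ) * Sg) :=
            mul_nonneg ((sq_nonneg _).trans hx1) (by positivity)
          linarith
        have h2 := mul_le_mul_of_nonneg_left h1 hw
        have h3 := mul_le_mul_of_nonneg_left hDx (by positivity : 0 ≤ 4 * (M : ℝ) * Cf)
        linarith
      · rw [if_neg (fun h => hxd h.2), neg_zero]
        have h1 : 2 * M * Cf * R' ≤ δ ^ 2 * (1 + a) ^ (-σ) * Sg := hL₀ (N - M) (by omega)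
        have h2 : δ ^ 2 ≤ ‖y‖ ^ 2 - y ⟨0, hn0⟩ ^ 2 := by
          refine le_trans ?_ hx1
          rw [← sq_abs (x ⟨1, hn⟩)]
          exact pow_le_pow_left₀ hδ.le (not_lt.1 hxd) 2
        have h3 := mul_le_mul_of_nonneg_right h2 (mul_nonneg ha'.le hSg0)
        have h4 := mul_le_mul_of_nonneg_left hyR (by positivity : 0 ≤ 2 * (M : ℝ) * Cf)
        exact mul_nonneg (by positivity) (by linarith)
    · rw [if_neg (fun h => hxR h.1), hR j hj x (not_le.1 hxR)]
      simp
  refine le_trans (le_of_eq ?_) (Finset.sum_le_sum hterm)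
  split_ifs <;> simp

/-- A bounded primitive, in the direction `xⱼ`, of a function concentrated near `xⱼ = 0`. -/
noncomputable def slabPrim (δ : ℝ) (j : Fin n) (x : Space n) : ℝ :=
  x j * (1 + (x j / δ) ^ 2) ^ (-(1 / 2) : ℝ)

theorem hasTemperateGrowth_slabPrim (δ : ℝ) (j : Fin n) :
    (slabPrim δ j : Space n → ℝ).HasTemperateGrowth := by
  have hp : (fun x : Space n => x j).HasTemperateGrowth :=
    (EuclideanSpace.proj j : Space n →L[ℝ] ℝ).hasTemperateGrowth
  have h1 : (fun x : Space n => (1 + (x j / δ) ^ 2) ^ (-(1 / 2) : ℝ)).HasTemperateGrowth := by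
    have := (Function.hasTemperateGrowth_one_add_norm_sq_rpow ℝ (-(1 / 2))).comp
      ((Function.HasTemperateGrowth.const (E := Space n) δ⁻¹).mul hp)
    have h : (fun x : Space n => (1 + (x j / δ) ^ 2) ^ (-(1 / 2) : ℝ)) =
        (fun t : ℝ => (1 + ‖t‖ ^ 2) ^ (-(1 / 2) : ℝ)) ∘
          ((fun _ : Space n => δ⁻¹) * fun x => x j) := by
      funext x
      simp only [Function.comp, Real.norm_eq_abs, sq_abs, Pi.mul_apply, div_eq_inv_mul]
    rw [h]
    exact this
  exact hp.mul h1

theorem fderiv_slabPrim {δ : ℝ} (hδ : 0 < δ) (j : Fin n) (x : Space n) :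
    fderiv ℝ (slabPrim δ j) x (EuclideanSpace.single j 1) =
      (1 + (x j / δ) ^ 2) ^ (-(3 / 2) : ℝ) := by
  have hp : HasFDerivAt (fun x : Space n => x j) (EuclideanSpace.proj j : Space n →L[ℝ] ℝ) x :=
    (EuclideanSpace.proj j : Space n →L[ℝ] ℝ).hasFDerivAt
  have hB : 0 < 1 + (x j / δ) ^ 2 := by positivity
  have h1 : HasDerivAt (fun t : ℝ => 1 + (t / δ) ^ 2) (2 * (x j / δ) * (1 / δ)) (x j) := by
    have := (((hasDerivAt_id (x j)).div_const δ).pow 2).const_add 1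
    simpa using this
  have h2 := (hasDerivAt_id (x j)).fun_mul (h1.rpow_const (p := (-(1 / 2) : ℝ)) (Or.inl hB.ne'))
  have h3 := (h2.comp_hasFDerivAt x hp).fderiv
  refine (congrArg (fun T : Space n →L[ℝ] ℝ => T (EuclideanSpace.single j 1)) h3).trans ?_
  have h4 : (1 + (x j / δ) ^ 2) ^ (-(1 / 2) : ℝ) =
      (1 + (x j / δ) ^ 2) ^ (-(3 / 2) : ℝ) * (1 + (x j / δ) ^ 2) := by
    rw [show (-(1 / 2) : ℝ) = -(3 / 2) + 1 by norm_num, Real.rpow_add hB, Real.rpow_one]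
  have h5 : (-(1 / 2) - 1 : ℝ) = -(3 / 2) := by norm_num
  have h6 : (EuclideanSpace.proj j : Space n →L[ℝ] ℝ) (EuclideanSpace.single j 1) = 1 := by simp
  simp only [smul_apply, id, smul_eq_mul, h4, h5, h6]
  field_simp
  ring

theorem abs_slabPrim_le {δ : ℝ} (hδ : 0 < δ) (j : Fin n) (x : Space n) : |slabPrim δ j x| ≤ δ := by
  have hB : 0 < 1 + (x j / δ) ^ 2 := by positivity
  rw [slabPrim, Real.rpow_neg hB.le, ← Real.sqrt_eq_rpow, abs_mul, abs_inv,
    abs_of_nonneg (Real.sqrt_nonneg _), ← div_eq_mul_inv, div_le_iff₀ (Real.sqrt_pos.2 hB)]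
  have h : |x j| / δ ≤ Real.sqrt (1 + (x j / δ) ^ 2) := by
    refine Real.le_sqrt_of_sq_le ?_
    rw [div_pow, div_pow, sq_abs]
    linarith
  rwa [div_le_iff₀ hδ, mul_comm] at h

/-- Thin slabs carry little mass, relative to the energy. -/
theorem exists_slab_le (ha : 0 < a) {σ η : ℝ} (hσ : 0 < σ) (hη : 0 < η) :
    ∃ C : ℝ, 0 ≤ C ∧ ∀ (j : Fin n) (δ : ℝ), 0 < δ → ∀ u : 𝓢(Space n, ℂ),
      (inner ℂ (incl n u) (incl n (mS (fun x => wt a (σ + 1) x *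
        fderiv ℝ (slabPrim δ j) x (EuclideanSpace.single j 1)) u))).re ≤
        C * δ * energy a σ η 0 u := by
  -- `A` bounds `wt a (σ + 1)` by the Hardy weight `wt a σ * invSq η`; this is what the extra power
  -- in the weight is for. `B` bounds the derivative of `wt a (σ + 1)` by that weight itself.
  set A : ℝ := 1 / a + η with hA
  have hA0 : 0 ≤ A := by positivity
  set B : ℝ := 2 * (σ + 1) * a * (1 + 1 / a) with hB
  have hB0 : 0 ≤ B := by positivity
  refine ⟨1 + A * (1 + B), by positivity, fun j δ hδ u => ?_⟩
  have hq := hasTemperateGrowth_wt (n := n) ha (σ + 1)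
  have hS := hasTemperateGrowth_slabPrim (n := n) δ j
  have hq' := hasTemperateGrowth_pderiv j hq
  have hS' := hasTemperateGrowth_pderiv j hS
  have hZ : (fun x => wt a (σ + 1) x * slabPrim δ j x : Space n → ℝ).HasTemperateGrowth :=
    hq.mul hS
  have hZ1 : (fun x => slabPrim δ j x * fderiv ℝ (wt a (σ + 1)) x (EuclideanSpace.single j 1) :
    Space n → ℝ).HasTemperateGrowth := hS.mul hq'
  have hZ2 : (fun x => wt a (σ + 1) x * fderiv ℝ (slabPrim δ j) x (EuclideanSpace.single j 1) :
    Space n → ℝ).HasTemperateGrowth := hq.mul hS'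
  have hd : ∀ x : Space n, fderiv ℝ (fun x => wt a (σ + 1) x * slabPrim δ j x) x
      (EuclideanSpace.single j 1) =
      wt a (σ + 1) x * fderiv ℝ (slabPrim δ j) x (EuclideanSpace.single j 1) +
      slabPrim δ j x * fderiv ℝ (wt a (σ + 1)) x (EuclideanSpace.single j 1) := by
    intro x
    rw [fderiv_fun_mul (hq.1.differentiable (by simp) x) (hS.1.differentiable (by simp) x)]
    simp
  -- The slab density is the derivative of `slabPrim`, which is at most δ in absolute value.
  -- Integration by parts moves the derivative to |u|² and to the weight, and every resulting term
  -- carries a factor δ.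
  have hibp := two_re_inner_dS j hZ (hZ2.add hZ1) hd u
  have htot := ((hasIntegral_inner_mS hZ (dS j u) u).const_mul 2).add
    (hasIntegral_inner_mS (hZ2.add hZ1) u u)
  rw [hibp, neg_add_cancel] at htot
  have hfin := (htot.const_mul (-1)).add (hasIntegral_inner_mS hZ2 u u)
  rw [mul_zero, zero_add] at hfin
  refine hfin.mono ((hasIntegral_energy ha σ hη 0 u).const_mul _) fun x => ?_
  have hp := (wt_pos ha σ x).le
  have hq0 := (wt_pos ha (σ + 1) x).le
  have hb := wt_base_pos ha x
  have hpq := wt_succ_mul ha σ x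
  have hqp : wt a (σ + 1) x ≤ wt a σ x := by
    rw [← hpq]
    exact le_mul_of_one_le_right hq0 (by nlinarith [sq_nonneg ‖x‖])
  have hqX : wt a (σ + 1) x ≤ A * (wt a σ x * invSq η x) := by
    rw [← hpq, invSq]
    have h1 : 1 ≤ A * ((1 + a * ‖x‖ ^ 2) * (‖x‖ ^ 2 + η)⁻¹) := by
      rw [← div_eq_mul_inv, ← mul_div_assoc, one_le_div (by positivity), hA]
      have : (1 / a + η) * (1 + a * ‖x‖ ^ 2) =
          ‖x‖ ^ 2 + η + 1 / a + η * a * ‖x‖ ^ 2 := by field_simp; ring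
      rw [this]
      have h2 : 0 ≤ 1 / a := by positivity
      have h3 : 0 ≤ η * a * ‖x‖ ^ 2 := by positivity
      linarith
    calc wt a (σ + 1) x = wt a (σ + 1) x * 1 := (mul_one _).symm
      _ ≤ wt a (σ + 1) x * (A * ((1 + a * ‖x‖ ^ 2) * (‖x‖ ^ 2 + η)⁻¹)) := by gcongr
      _ = _ := by ring
  have hdq : |fderiv ℝ (wt a (σ + 1)) x (EuclideanSpace.single j 1)| ≤ B * wt a (σ + 1) x := by
    rw [(hasRadialGrad_wt ha (σ + 1) x).fderiv]
    simp only [smul_apply, innerSL_apply_apply, inner_single_one, smul_eq_mul]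
    have h1 : |x j| ≤ (1 + 1 / a) * (1 + a * ‖x‖ ^ 2) := by
      have h2 : |x j| ≤ ‖x‖ := by simpa using PiLp.norm_apply_le x j
      have : (1 + 1 / a) * (1 + a * ‖x‖ ^ 2) = 1 + ‖x‖ ^ 2 + 1 / a + a * ‖x‖ ^ 2 := by
        field_simp; ring
      rw [this]
      have h3 : 0 ≤ 1 / a := by positivity
      have h4 : 0 ≤ a * ‖x‖ ^ 2 := by positivity
      nlinarith [sq_nonneg (‖x‖ - 1)]
    have hq2 := (wt_pos ha (σ + 1 + 1) x).le
    rw [← wt_succ_mul ha (σ + 1) x, abs_mul, abs_mul, abs_of_nonneg hq2,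
      show |-2 * (σ + 1) * a| = 2 * (σ + 1) * a by
        rw [show -2 * (σ + 1) * a = -(2 * (σ + 1) * a) by ring, abs_neg,
          abs_of_nonneg (by positivity)]]
    calc 2 * (σ + 1) * a * wt a (σ + 1 + 1) x * |x j|
        ≤ 2 * (σ + 1) * a * wt a (σ + 1 + 1) x * ((1 + 1 / a) * (1 + a * ‖x‖ ^ 2)) := by gcongr
      _ = _ := by rw [hB]; ring
  have hH := abs_slabPrim_le hδ j x
  have hre : |(inner ℂ (dS j u x) (u x)).re| ≤ ‖dS j u x‖ * ‖u x‖ :=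
    (Complex.abs_re_le_norm _).trans (norm_inner_le_norm _ _)
  have hsum : ‖dS j u x‖ ^ 2 ≤ ∑ k, ‖dS k u x‖ ^ 2 :=
    Finset.single_le_sum (f := fun k => ‖dS k u x‖ ^ 2) (fun _ _ => sq_nonneg _)
      (Finset.mem_univ j)
  simp only [sub_zero, Pi.add_apply, ← norm_sq_eq_re_inner]
  have t1 : -(wt a (σ + 1) x * slabPrim δ j x * (inner ℂ (dS j u x) (u x)).re) ≤
      wt a (σ + 1) x * (δ * (‖dS j u x‖ * ‖u x‖)) := by
    rw [mul_assoc, ← mul_neg]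
    refine mul_le_mul_of_nonneg_left ((neg_le_abs _).trans ?_) hq0
    rw [abs_mul]
    gcongr
  have t2 : -(slabPrim δ j x * fderiv ℝ (wt a (σ + 1)) x (EuclideanSpace.single j 1)) ≤
      δ * (B * wt a (σ + 1) x) := by
    refine (neg_le_abs _).trans ?_
    rw [abs_mul]
    gcongr
  have t2' := mul_le_mul_of_nonneg_right t2 (sq_nonneg ‖u x‖)
  have t3 : 2 * (‖dS j u x‖ * ‖u x‖) ≤ ‖dS j u x‖ ^ 2 + ‖u x‖ ^ 2 := by
    nlinarith [sq_nonneg (‖dS j u x‖ - ‖u x‖)]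
  have t4 := mul_le_mul_of_nonneg_left t3 (mul_nonneg hq0 hδ.le)
  have hS0 : 0 ≤ ∑ k, ‖dS k u x‖ ^ 2 := Finset.sum_nonneg fun _ _ => sq_nonneg _
  have hX0 : 0 ≤ invSq η x := by rw [invSq]; positivity
  have t5 : δ * (wt a (σ + 1) x * ‖dS j u x‖ ^ 2) ≤
      (1 + A * (1 + B)) * δ * (wt a σ x * ∑ k, ‖dS k u x‖ ^ 2) := by
    calc δ * (wt a (σ + 1) x * ‖dS j u x‖ ^ 2) ≤ δ * (wt a σ x * ∑ k, ‖dS k u x‖ ^ 2) := by gcongr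
      _ ≤ _ := by
        refine mul_le_mul_of_nonneg_right ?_ (by positivity)
        nlinarith [mul_nonneg hA0 (by linarith : 0 ≤ 1 + B)]
  have t6 : δ * (1 + B) * (wt a (σ + 1) x * ‖u x‖ ^ 2) ≤
      (1 + A * (1 + B)) * δ * (wt a σ x * invSq η x * ‖u x‖ ^ 2) := by
    calc δ * (1 + B) * (wt a (σ + 1) x * ‖u x‖ ^ 2)
        ≤ δ * (1 + B) * (A * (wt a σ x * invSq η x) * ‖u x‖ ^ 2) := by gcongr
      _ = (A * (1 + B)) * δ * (wt a σ x * invSq η x * ‖u x‖ ^ 2) := by ring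
      _ ≤ _ := by
        refine mul_le_mul_of_nonneg_right ?_ (by positivity)
        nlinarith
  linarith

end PotentialBound

/-! ### The commutator estimate for Schwartz functions. -/

section SchwartzInequality

variable {n : ℕ} {a : ℝ}

theorem mS_sum {ι : Type*} (s : Finset ι) {G : ι → Space n → ℝ}
    (hG : ∀ i ∈ s, (G i).HasTemperateGrowth) :
    mS (fun x => ∑ i ∈ s, G i x) = ∑ i ∈ s, mS (G i) := by
  ext u x
  simp only [LinearMap.sum_apply, sum_apply]
  rw [mS_apply (.sum hG), Complex.ofReal_sum, Finset.sum_mul]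
  exact Finset.sum_congr rfl fun i hi => (mS_apply (hG i hi) u x).symm

theorem fieldOp_sum {ι : Type*} (s : Finset ι) {G : ι → Fin n → Space n → ℝ}
    (hG : ∀ i ∈ s, ∀ k, (G i k).HasTemperateGrowth) :
    fieldOp (fun k x => ∑ i ∈ s, G i k x) = ∑ i ∈ s, fieldOp (G i) := by
  simp only [fieldOp]
  rw [Finset.sum_comm]
  refine Finset.sum_congr rfl fun k _ => ?_
  rw [mS_sum s fun i hi => hG i hi k, Finset.sum_add_distrib]
  congr 1
  · ext u
    simp [LinearMap.sum_apply, map_sum]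
  · ext u
    simp [LinearMap.sum_apply]

theorem energy_nonneg (ha : 0 < a) (σ : ℝ) {η : ℝ} (hη : 0 < η) (b : Space n)
    (u : 𝓢(Space n, ℂ)) : 0 ≤ energy a σ η b u := by
  rw [← (hasIntegral_energy ha σ hη b u).2]
  refine integral_nonneg fun x => ?_
  have h1 := (wt_pos ha σ (x - b)).le
  have h2 : 0 ≤ invSq η (x - b) := by rw [invSq]; positivity
  simp only [Pi.zero_apply]
  positivity

/-- The components of `∇ ∑_{|l| ≤ N} F_{b_l}`. -/
noncomputable def gradSum (a σ : ℝ) (N : ℕ) (k : Fin n) (x : Space n) : ℝ :=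
  ∑ l ∈ Finset.Icc (-(N : ℤ)) N, gradFc a σ (latticePoint n l) k x

theorem gradSum_hasTemperateGrowth (ha : 0 < a) (σ : ℝ) (N : ℕ) (k : Fin n) :
    (gradSum a σ N k : Space n → ℝ).HasTemperateGrowth :=
  .sum fun _ _ => gradFc_hasTemperateGrowth ha σ _ k

theorem gradSum_eq (ha : 0 < a) (σ : ℝ) (N : ℕ) (k : Fin n) (x : Space n) :
    gradSum a σ N k x = latticeField a σ N x k := by
  simp [gradSum, latticeField, gradFc_eq ha]

theorem clm_apply_eq_sum (T : Space n →L[ℝ] ℝ) (v : Space n) :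
    T v = ∑ k, T (EuclideanSpace.single k 1) * v k := by
  have h := (EuclideanSpace.basisFun (Fin n) ℝ).sum_repr v
  conv_lhs => rw [← h]
  rw [map_sum]
  refine Finset.sum_congr rfl fun k _ => ?_
  rw [map_smul, smul_eq_mul, mul_comm]
  simp

theorem hasTemperateGrowth_latticePotential (M : ℕ) (V : ℤ → ℝ → ℝ)
    (hV_smooth : ∀ j ∈ Finset.Icc (-(M : ℤ)) M,
      ContDiff ℝ ((⊤ : ℕ∞) : WithTop ℕ∞) (bump n (V j) j))
    (hV_supp : ∀ j ∈ Finset.Icc (-(M : ℤ)) M, HasCompactSupport (bump n (V j) j)) :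
    (latticePotential n M V).HasTemperateGrowth :=
  .sum fun j hj => (hV_supp j hj).hasTemperateGrowth (hV_smooth j hj)

/-- The commutator estimate on Schwartz functions. -/
theorem exists_schwartz_inequality (hn : 3 ≤ n) (ha : 0 < a) {σ : ℝ} (hσ : 1 / 2 < σ)
    (hσ' : σ < 4 * ((n : ℝ) - 2) ^ 2) (M : ℕ) (V : ℤ → ℝ → ℝ)
    (hV_smooth : ∀ j ∈ Finset.Icc (-(M : ℤ)) M,
      ContDiff ℝ ((⊤ : ℕ∞) : WithTop ℕ∞) (bump n (V j) j))
    (hV_supp : ∀ j ∈ Finset.Icc (-(M : ℤ)) M, HasCompactSupport (bump n (V j) j))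
    (hV_decr : ∀ j ∈ Finset.Icc (-(M : ℤ)) M, AntitoneOn (V j) (Set.Ici 0))
    {ε : ℝ} (hε : 0 < ε) :
    ∃ Nε : ℕ, M ≤ Nε ∧ ∀ N : ℕ, Nε ≤ N → ∀ u : 𝓢(Space n, ℂ),
      0 ≤ ε * (2 * (inner ℂ (incl n (negLapS n u)) (incl n (fieldOp (gradSum a σ N) u))).re) +
        2 * (inner ℂ (incl n (mS (latticePotential n M V) u))
          (incl n (fieldOp (gradSum a σ N) u))).re := by
  have hσ0 : 0 < σ := by linarith
  have hn2 : 2 ≤ n := by omega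
  obtain ⟨θ, η, hθ, hη, hE⟩ := exists_energy_le hn ha hσ0 hσ'
  obtain ⟨R, C, hC, hpot⟩ := exists_potential_bound hn2 ha hσ M V hV_smooth hV_supp hV_decr
  obtain ⟨C', hC', hslab⟩ := exists_slab_le (n := n) ha hσ0 hη
  have hV := hasTemperateGrowth_latticePotential M V hV_smooth hV_supp
  set i₁ : Fin n := ⟨1, hn2⟩ with hi₁
  -- A lower bound, independent of δ, for the density of `exists_slab_le` on |x| ≤ R, |x₁| < δ.
  set m : ℝ := (1 + a * R ^ 2) ^ (-(σ + 1)) * (2 : ℝ) ^ (-(3 / 2) : ℝ) with hm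
  have hm0 : 0 < m := by positivity
  -- Chosen so that (C/m) C' δ ≤ εθ; the 1 keeps the denominator positive.
  set δ : ℝ := ε * θ / (C / m * C' + 1) with hδ
  have hδ0 : 0 < δ := by positivity
  obtain ⟨N₀, hMN, hN₀⟩ := hpot δ hδ0
  refine ⟨N₀, hMN, fun N hN u => ?_⟩
  have hG := gradSum_hasTemperateGrowth (n := n) ha σ N
  -- All centers give nonnegative contributions; only the one at 0 is retained, whence a bound
  -- independent of N.
  have hfree : θ * energy a σ η 0 u ≤
      2 * (inner ℂ (incl n (negLapS n u)) (incl n (fieldOp (gradSum a σ N) u))).re := by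
    have h1 : fieldOp (gradSum a σ N) =
        ∑ l ∈ Finset.Icc (-(N : ℤ)) N, fieldOp (gradFc a σ (latticePoint n l)) :=
      fieldOp_sum _ fun l _ k => gradFc_hasTemperateGrowth ha σ _ k
    rw [h1, LinearMap.sum_apply, map_sum, inner_sum, Complex.re_sum, Finset.mul_sum]
    have h0 : latticePoint n 0 = 0 := by
      rw [latticePoint_eq (by omega : 0 < n)]
      simp
    refine (hE 0 u).trans ?_
    rw [← h0]
    exact Finset.single_le_sum (f := fun l => 2 * (inner ℂ (incl n (negLapS n u))
      (incl n (fieldOp (gradFc a σ (latticePoint n l)) u))).re)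
      (fun l _ => (mul_nonneg hθ.le (energy_nonneg ha σ hη _ u)).trans (hE _ u))
      (Finset.mem_Icc.2 ⟨by omega, by omega⟩)
  have hWg : (fun x => -2 * ∑ k, fderiv ℝ (latticePotential n M V) x (EuclideanSpace.single k 1) *
      gradSum a σ N k x : Space n → ℝ).HasTemperateGrowth :=
    (Function.HasTemperateGrowth.const _).mul
      (.sum fun k _ => (hasTemperateGrowth_pderiv k hV).mul (hG k))
  have hvp := virial_potential (gradSum a σ N) (latticePotential n M V) _ hG hV hWg
    (fun _ => rfl) u
  have hS := (hasTemperateGrowth_wt (n := n) ha (σ + 1)).mul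
    (hasTemperateGrowth_pderiv i₁ (hasTemperateGrowth_slabPrim (n := n) δ i₁))
  have hcmp : -(C / m) * (inner ℂ (incl n u) (incl n (mS (fun x => wt a (σ + 1) x *
      fderiv ℝ (slabPrim δ i₁) x (EuclideanSpace.single i₁ 1)) u))).re ≤
      2 * (inner ℂ (incl n (mS (latticePotential n M V) u))
          (incl n (fieldOp (gradSum a σ N) u))).re := by
    rw [fieldOp_apply, hvp]
    refine ((hasIntegral_inner_mS hS u u).const_mul _).mono (hasIntegral_inner_mS hWg u u)
      fun x => ?_
    rw [← norm_sq_eq_re_inner, ← mul_assoc]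
    refine mul_le_mul_of_nonneg_right ?_ (sq_nonneg _)
    have h1 := hN₀ N hN x
    rw [clm_apply_eq_sum] at h1
    simp only [gradSum_eq ha]
    refine le_trans ?_ h1
    have hq := wt_pos ha (σ + 1) x
    simp only [Pi.mul_apply, fderiv_slabPrim hδ0]
    split_ifs with hx
    · rw [neg_mul]
      refine neg_le_neg ?_
      have h2 : m ≤ wt a (σ + 1) x * (1 + (x i₁ / δ) ^ 2) ^ (-(3 / 2) : ℝ) := by
        rw [hm]
        refine mul_le_mul ?_ ?_ (by positivity) hq.le
        · refine Real.rpow_le_rpow_of_nonpos (wt_base_pos ha x) ?_ (by linarith)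
          gcongr
          exact hx.1
        · refine Real.rpow_le_rpow_of_nonpos (by positivity) ?_ (by norm_num)
          have h3 : (x i₁ / δ) ^ 2 ≤ 1 := by
            rw [sq_le_one_iff_abs_le_one, abs_div, abs_of_pos hδ0, div_le_one hδ0]
            exact hx.2.le
          linarith
      calc C = C / m * m := by field_simp
        _ ≤ _ := by gcongr
    · rw [neg_zero, neg_mul, neg_nonpos]
      positivity
  have hs := mul_le_mul_of_nonneg_left (hslab i₁ δ hδ0 u) (by positivity : 0 ≤ C / m)
  have hE0 := energy_nonneg (n := n) ha σ hη 0 u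
  have hδle : C / m * C' * δ ≤ ε * θ := by
    rw [hδ, mul_div_assoc', div_le_iff₀ (by positivity)]
    nlinarith [mul_pos hε hθ]
  have h1 := mul_le_mul_of_nonneg_right hδle hE0
  have h2 := mul_le_mul_of_nonneg_left hfree hε.le
  linarith

end SchwartzInequality

/-! ### Distributional operators agree with their Schwartz versions and are continuous. -/

section Intertwining

variable {n : ℕ}

theorem toDist_incl (u : 𝓢(Space n, ℂ)) :
    toDist n (incl n u) = SchwartzMap.toTemperedDistributionCLM (Space n) ℂ volume u :=
  Lp.toTemperedDistribution_toLp_eq u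

theorem toDist_incl_apply (u φ : 𝓢(Space n, ℂ)) : toDist n (incl n u) φ = ∫ x, φ x • u x := by
  rw [toDist_incl]
  exact SchwartzMap.toTemperedDistributionCLM_apply_apply volume u φ

theorem partialD_toDist (j : Fin n) (u : 𝓢(Space n, ℂ)) :
    partialD j (toDist n (incl n u)) = toDist n (incl n (dS j u)) := by
  rw [toDist_incl, toDist_incl]
  exact TemperedDistribution.lineDerivOp_toTemperedDistributionCLM_eq u _

theorem mulBy_toDist {G : Space n → ℝ} (hG : G.HasTemperateGrowth) (u : 𝓢(Space n, ℂ)) :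
    mulBy G (toDist n (incl n u)) = toDist n (incl n (mS G u)) := by
  ext φ
  rw [toDist_incl_apply]
  refine (TemperedDistribution.smulLeftCLM_apply_apply _ _ _).trans ?_
  rw [toDist_incl_apply]
  congr 1
  ext x
  rw [SchwartzMap.smulLeftCLM_apply_apply (hasTemperateGrowth_ofReal hG), mS_apply hG]
  simp only [smul_eq_mul]
  ring

theorem partialD_apply (j : Fin n) (T : Dist n) (φ : 𝓢(Space n, ℂ)) :
    partialD j T φ = -T (dS j φ) :=
  (TemperedDistribution.lineDerivOp_apply_apply T φ _).trans (map_neg T _)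

theorem continuous_partialD (j : Fin n) : Continuous (partialD (n := n) j) :=
  (LineDeriv.lineDerivOpCLM ℂ (Dist n) (EuclideanSpace.single j (1 : ℝ) : Space n)).continuous

theorem continuous_mulBy (G : Space n → ℝ) : Continuous (mulBy G) :=
  (TemperedDistribution.smulLeftCLM ℂ (fun x => (G x : ℂ)) : Dist n →L[ℂ] Dist n).continuous

theorem continuous_toDist : Continuous (toDist n) :=
  (Lp.toTemperedDistributionCLM ℂ (volume : Measure (Space n)) 2).continuous

theorem continuous_negLaplacianDist : Continuous (negLaplacianDist n) := by
  have h : ⇑(negLaplacianDist n) = fun u => -∑ j, partialD j (partialD j u) := by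
    ext u : 1
    simp [negLaplacianDist, LinearMap.sum_apply]
  rw [h]
  exact (continuous_finsetSum _ fun j _ =>
    (continuous_partialD j).comp (continuous_partialD j)).neg

theorem negLaplacianDist_toDist (u : 𝓢(Space n, ℂ)) :
    negLaplacianDist n (toDist n (incl n u)) = toDist n (incl n (negLapS n u)) := by
  rw [negLapS_apply, map_neg, map_neg, map_sum, map_sum]
  simp [negLaplacianDist, LinearMap.sum_apply, partialD_toDist]

theorem negLaplacianDist_apply (T : Dist n) (φ : 𝓢(Space n, ℂ)) :
    negLaplacianDist n T φ = T (negLapS n φ) := by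
  rw [negLapS_apply, map_neg, map_sum, ← Finset.sum_neg_distrib]
  have h : negLaplacianDist n T φ = -∑ j, partialD j (partialD j T) φ := by
    simp only [negLaplacianDist, LinearMap.neg_apply, LinearMap.sum_apply, LinearMap.comp_apply]
    rw [neg_apply, sum_apply]
  rw [h, ← Finset.sum_neg_distrib]
  exact Finset.sum_congr rfl fun j _ => by rw [partialD_apply, partialD_apply, neg_neg]

theorem gammaDist_apply (a σ : ℝ) (c : Space n) (u : Dist n) :
    gammaDist a σ c u = (-Complex.I) • ∑ j, (partialD j (mulBy (gradFc a σ c j) u) +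
      mulBy (gradFc a σ c j) (partialD j u)) := by
  simp only [gammaDist, LinearMap.smul_apply, LinearMap.sum_apply, LinearMap.add_apply,
    LinearMap.comp_apply]

theorem continuous_gammaDist (a σ : ℝ) (c : Space n) : Continuous (gammaDist a σ c) := by
  rw [show ⇑(gammaDist a σ c) = _ from funext (gammaDist_apply a σ c)]
  have h : Continuous fun u : Dist n => ∑ j, (partialD j (mulBy (gradFc a σ c j) u) +
      mulBy (gradFc a σ c j) (partialD j u)) := continuous_finsetSum _ fun j _ =>
    ((continuous_partialD j).comp (continuous_mulBy _)).add
      ((continuous_mulBy _).comp (continuous_partialD j))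
  exact h.const_smul (-Complex.I)

theorem sum_gammaDist_toDist {a : ℝ} (ha : 0 < a) (σ : ℝ) (N : ℕ) (u : 𝓢(Space n, ℂ)) :
    (∑ k ∈ Finset.Icc (-(N : ℤ)) N, gammaDist a σ (latticePoint n k)) (toDist n (incl n u)) =
      toDist n (incl n ((-Complex.I) • fieldOp (gradSum a σ N) u)) := by
  have h1 : fieldOp (gradSum a σ N) =
      ∑ l ∈ Finset.Icc (-(N : ℤ)) N, fieldOp (gradFc a σ (latticePoint n l)) :=
    fieldOp_sum _ fun l _ k => gradFc_hasTemperateGrowth ha σ _ k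
  rw [h1, LinearMap.sum_apply, LinearMap.sum_apply, Finset.smul_sum, map_sum, map_sum]
  refine Finset.sum_congr rfl fun l _ => ?_
  rw [gammaDist_apply, fieldOp_apply, map_smul, map_smul, map_sum, map_sum]
  simp only [map_add, partialD_toDist, mulBy_toDist (gradFc_hasTemperateGrowth ha σ _ _)]

end Intertwining

/-! ### Density of Schwartz functions in D(-Δ) through the resolvent. -/

section Density

variable {n : ℕ}

open scoped Laplacian

theorem negLapS_eq (u : 𝓢(Space n, ℂ)) : negLapS n u = -Δ u := by
  rw [negLapS_apply, SchwartzMap.laplacian_eq_sum (EuclideanSpace.basisFun (Fin n) ℝ)]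
  simp [dS]

/-- The Fourier symbol of -Δ is (2π)²|ξ|², so with the spectral parameter (2π)² the inverse is the
multiplier (2π)⁻²(1+|ξ|²)⁻¹, which preserves the Schwartz space. -/
theorem exists_resolvent (f : 𝓢(Space n, ℂ)) :
    ∃ φ : 𝓢(Space n, ℂ), ((2 * Real.pi) ^ 2 : ℝ) • φ + negLapS n φ = f := by
  have hB := Function.hasTemperateGrowth_one_add_norm_sq_rpow (Space n) (-1)
  set B : Space n → ℝ := fun x => (1 + ‖x‖ ^ 2) ^ (-1 : ℝ) with hBdef
  have hS : (fun x : Space n => ‖x‖ ^ 2).HasTemperateGrowth := by fun_prop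
  have hsum : SchwartzMap.fourierMultiplierCLM ℂ (fun x : Space n => ‖x‖ ^ 2)
      (SchwartzMap.fourierMultiplierCLM ℂ B f) + SchwartzMap.fourierMultiplierCLM ℂ B f = f := by
    rw [SchwartzMap.fourierMultiplierCLM_fourierMultiplierCLM_apply hS hB]
    have h2 := SchwartzMap.fourierMultiplierCLM_sum (𝕜 := ℝ) (E := Space n) ℂ (s := Finset.univ)
      (g := fun i : Bool => if i then ((fun x : Space n => ‖x‖ ^ 2) * B) else B) (by
        intro i _
        cases i
        · exact hB
        · exact hS.mul hB)
    have h3 : (fun x : Space n => ∑ i : Bool,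
        (if i then ((fun x : Space n => ‖x‖ ^ 2) * B) else B) x) = fun _ => 1 := by
      funext x
      have : 0 < 1 + ‖x‖ ^ 2 := by positivity
      simp only [Fintype.sum_bool, if_true, Pi.mul_apply, hBdef, Real.rpow_neg_one,
        Bool.false_eq_true, if_false]
      field_simp
      ring
    rw [h3] at h2
    have h4 := congrArg (fun T => T f) h2
    simpa [SchwartzMap.fourierMultiplierCLM_const] using h4.symm
  refine ⟨((2 * Real.pi) ^ 2 : ℝ)⁻¹ • SchwartzMap.fourierMultiplierCLM ℂ B f, ?_⟩
  have h0 : ((2 * Real.pi) ^ 2 : ℝ) ≠ 0 := by positivity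
  rw [negLapS_eq, SchwartzMap.laplacian_eq_fourierMultiplierCLM, map_smul, smul_inv_smul₀ h0,
    neg_smul, smul_inv_smul₀ h0, neg_neg, add_comm]
  exact hsum

/-- `‖∂ⱼ u‖² ≤ ‖u‖ ‖-Δ u‖`. -/
theorem sum_norm_dS_sq (u : 𝓢(Space n, ℂ)) :
    ∑ j, ‖incl n (dS j u)‖ ^ 2 = (inner ℂ (incl n u) (incl n (negLapS n u))).re := by
  rw [negLapS_apply, map_neg, inner_neg_right, map_sum, inner_sum, Complex.neg_re, Complex.re_sum,
    ← Finset.sum_neg_distrib]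
  refine Finset.sum_congr rfl fun j _ => ?_
  rw [inner_dS, Complex.neg_re, neg_neg, ← inner_self_eq_norm_sq (𝕜 := ℂ), RCLike.re_eq_complex_re]

theorem norm_dS_le (j : Fin n) (u : 𝓢(Space n, ℂ)) :
    ‖incl n (dS j u)‖ ≤ ‖incl n u‖ + ‖incl n (negLapS n u)‖ := by
  have h1 : ‖incl n (dS j u)‖ ^ 2 ≤ ∑ j, ‖incl n (dS j u)‖ ^ 2 :=
    Finset.single_le_sum (f := fun j => ‖incl n (dS j u)‖ ^ 2) (fun _ _ => sq_nonneg _)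
      (Finset.mem_univ j)
  rw [sum_norm_dS_sq] at h1
  have h2 := re_inner_le_norm (𝕜 := ℂ) (incl n u) (incl n (negLapS n u))
  rw [RCLike.re_eq_complex_re] at h2
  refine abs_le_of_sq_le_sq' ?_ (by positivity) |>.2
  nlinarith [norm_nonneg (incl n u), norm_nonneg (incl n (negLapS n u))]

theorem norm_le_resolvent (c : ℝ) (u : 𝓢(Space n, ℂ)) :
    c * ‖incl n u‖ ≤ ‖incl n (c • u + negLapS n u)‖ := by
  have h1 : c * ‖incl n u‖ ^ 2 ≤ (inner ℂ (incl n u) (incl n (c • u + negLapS n u))).re := by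
    have h2 : incl n (c • u) = (c : ℂ) • incl n u := by
      rw [← map_smul]
      rfl
    rw [map_add, inner_add_right, Complex.add_re, ← sum_norm_dS_sq, h2, inner_smul_right,
      Complex.re_ofReal_mul, ← RCLike.re_eq_complex_re, inner_self_eq_norm_sq]
    have : 0 ≤ ∑ j, ‖incl n (dS j u)‖ ^ 2 := Finset.sum_nonneg fun _ _ => sq_nonneg _
    linarith
  have h3 := re_inner_le_norm (𝕜 := ℂ) (incl n u) (incl n (c • u + negLapS n u))
  rw [RCLike.re_eq_complex_re] at h3
  rcases (norm_nonneg (incl n u)).eq_or_lt with h0 | h0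
  · rw [← h0, mul_zero]
    exact norm_nonneg _
  · nlinarith

/-- Schwartz functions are dense in `D(-Δ)` for the graph norm. -/
theorem exists_schwartz_seq (u w : L2 n) (h : toDist n w = negLaplacianDist n (toDist n u)) :
    ∃ φ : ℕ → 𝓢(Space n, ℂ), Filter.Tendsto (fun m => incl n (φ m)) Filter.atTop (nhds u) ∧
      Filter.Tendsto (fun m => incl n (negLapS n (φ m))) Filter.atTop (nhds w) := by
  set c : ℝ := (2 * Real.pi) ^ 2
  have hc0 : 0 < c := by positivity
  have hd : DenseRange (incl n) :=
    SchwartzMap.denseRange_toLpCLM (E := Space n) (F := ℂ) (p := 2) (by simp) (μ := volume)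
  obtain ⟨F, hF, hlim⟩ := mem_closure_iff_seq_limit.1 (hd ((c : ℂ) • u + w))
  choose f hf using hF
  choose φ hφ using fun m => exists_resolvent (f m)
  have hincl : ∀ m, F m = (c : ℂ) • incl n (φ m) + incl n (negLapS n (φ m)) := by
    intro m
    rw [← hf, ← hφ, map_add, ← map_smul]
    rfl
  -- The resolvents φ_m of Schwartz approximations of (c-Δ)u are Cauchy by `norm_le_resolvent`.
  have hcau : CauchySeq fun m => incl n (φ m) := by
    have h1 := hlim.cauchySeq
    rw [Metric.cauchySeq_iff] at h1 ⊢
    intro ε hε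
    obtain ⟨N, hN⟩ := h1 (c * ε) (by positivity)
    refine ⟨N, fun m hm k hk => ?_⟩
    have h2 := norm_le_resolvent c (φ m - φ k)
    have h3 : incl n (c • (φ m - φ k) + negLapS n (φ m - φ k)) = F m - F k := by
      rw [← hf, ← hf, ← hφ, ← hφ, ← map_sub]
      congr 1
      rw [map_sub, smul_sub]
      abel
    rw [h3, map_sub, ← dist_eq_norm, ← dist_eq_norm] at h2
    exact lt_of_mul_lt_mul_left (h2.trans_lt (hN m hm k hk)) hc0.le
  obtain ⟨v, hv⟩ := cauchySeq_tendsto_of_complete hcau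
  have hlap : Filter.Tendsto (fun m => incl n (negLapS n (φ m))) Filter.atTop
      (nhds ((c : ℂ) • u + w - (c : ℂ) • v)) := by
    refine (hlim.sub (hv.const_smul (c : ℂ))).congr fun m => ?_
    rw [hincl, add_sub_cancel_left]
  have hv' : toDist n ((c : ℂ) • u + w - (c : ℂ) • v) = negLaplacianDist n (toDist n v) := by
    refine tendsto_nhds_unique ((continuous_toDist.tendsto _).comp hlap) ?_
    refine (((continuous_negLaplacianDist.comp continuous_toDist).tendsto v).comp hv).congr
      fun m => ?_
    exact negLaplacianDist_toDist (φ m)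
  -- Uniqueness by duality: (c-Δ)(u-v) = 0 as a distribution, and every test function has the form
  -- (c-Δ)η with η Schwartz.
  have huv : u = v := by
    refine sub_eq_zero.1 (toDist_injective n ?_)
    have h1 : (c : ℂ) • toDist n (u - v) + negLaplacianDist n (toDist n (u - v)) = 0 := by
      rw [map_sub, map_sub, ← h, ← hv']
      simp only [map_sub, map_add, map_smul, smul_sub]
      abel
    rw [map_zero]
    ext ψ
    obtain ⟨η, hη⟩ := exists_resolvent ψ
    have h2 : (negLaplacianDist n (toDist n (u - v))) η = toDist n (u - v) (negLapS n η) := by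
      exact negLaplacianDist_apply _ η
    have h3 := congrArg (fun T : Dist n => T η) h1
    rw [← hη, map_add, ← h2]
    refine Eq.trans ?_ h3
    congr 1
    exact map_smul (toDist n (u - v)) (c : ℂ) η
  subst huv
  refine ⟨φ, hv, ?_⟩
  simpa using hlap

end Density

/-! ### Boundedness of the multiplier relative to -Δ. -/

section RelativeBounds

variable {n : ℕ} {a : ℝ}

theorem norm_mS_le {G : Space n → ℝ} (hG : G.HasTemperateGrowth) {C : ℝ} (hC0 : 0 ≤ C)
    (hC : ∀ x, |G x| ≤ C) (u : 𝓢(Space n, ℂ)) : ‖incl n (mS G u)‖ ≤ C * ‖incl n u‖ := by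
  have h1 : ∀ v : 𝓢(Space n, ℂ), HasIntegral (fun x => ‖v x‖ ^ 2) (‖incl n v‖ ^ 2) := by
    intro v
    have h := hasIntegral_inner_mS (.const (1 : ℝ)) v v
    have h2 : mS (fun _ => (1 : ℝ)) v = v := by
      ext x
      simp [mS_apply (.const (1 : ℝ))]
    have h3 : (inner ℂ (incl n v) (incl n v)).re = ‖incl n v‖ ^ 2 := by
      rw [← RCLike.re_eq_complex_re, inner_self_eq_norm_sq]
    rw [h2, h3] at h
    simpa only [one_mul, ← norm_sq_eq_re_inner] using h
  refine abs_le_of_sq_le_sq' ?_ (by positivity) |>.2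
  rw [mul_pow]
  refine (h1 (mS G u)).mono ((h1 u).const_mul (C ^ 2)) fun x => ?_
  rw [mS_apply hG, norm_mul, Complex.norm_real, mul_pow]
  gcongr
  exact hC x

theorem abs_coord_le (y : Space n) (k : Fin n) : |y k| ≤ ‖y‖ := by
  simpa using PiLp.norm_apply_le y k

theorem exists_norm_fieldOp_gradFc_le (ha : 0 < a) {σ : ℝ} (hσ : 1 / 2 < σ) :
    ∃ C, 0 ≤ C ∧ ∀ (b : Space n) (u : 𝓢(Space n, ℂ)), ‖incl n (fieldOp (gradFc a σ b) u)‖ ≤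
      C * (‖incl n u‖ + ‖incl n (negLapS n u)‖) := by
  have hσ0 : 0 ≤ σ := by linarith
  obtain ⟨K, hK0, hK⟩ := exists_norm_mul_radK_le (n := n) ha hσ
  have hgrad : ∀ (b : Space n) k x, |gradFc a σ b k x| ≤ K := by
    intro b k x
    rw [gradFc_eq ha, abs_mul, abs_of_pos (radK_pos ha hσ0 _), mul_comm]
    exact (mul_le_mul_of_nonneg_right (abs_coord_le _ k) (radK_pos ha hσ0 _).le).trans (hK _)
  -- The entry `radK - radM * y_k²` lies in [0, 1], because `radM * y_k² ≤ radM * ‖y‖² ≤ radK ≤ 1`.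
  have hhess : ∀ (b : Space n) k x, |hessFc a σ b k k x| ≤ 1 := by
    intro b k x
    have h1 := radM_nonneg ha hσ0 (x - b)
    have h2 := radK_eq ha σ (x - b)
    have h3 := radK_le_one ha hσ0 (x - b)
    have h4 := (wt_pos ha σ (x - b)).le
    have h5 := mul_le_mul_of_nonneg_left (sq_le_sq' (neg_le_of_abs_le (abs_coord_le (x - b) k))
      (le_of_abs_le (abs_coord_le (x - b) k))) h1
    have h6 := mul_nonneg h1 (sq_nonneg ((x - b) k))
    simp only [hessFc, if_true, mul_one]
    rw [abs_le]
    constructor <;> nlinarith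
  refine ⟨n * (1 + 2 * K), by positivity, fun b u => ?_⟩
  rw [fieldOp_apply, map_sum]
  refine (norm_sum_le _ _).trans ?_
  rw [mul_assoc, ← nsmul_eq_mul]
  refine (Finset.sum_le_card_nsmul _ _ ((1 + 2 * K) * (‖incl n u‖ + ‖incl n (negLapS n u)‖))
    fun k _ => ?_).trans_eq (by simp)
  have hG := gradFc_hasTemperateGrowth ha σ b k
  have hH := hessFc_hasTemperateGrowth ha σ b k k
  rw [dS_mS k hG hH fun x => fderiv_gradFc ha σ b k k x, map_add, map_add]
  have h1 := norm_mS_le hH zero_le_one (hhess b k) u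
  have h2 := norm_mS_le hG hK0 (hgrad b k) (dS k u)
  have h3 := mul_le_mul_of_nonneg_left (norm_dS_le k u) hK0
  have h4 := norm_add_le (incl n (mS (hessFc a σ b k k) u) + incl n (mS (gradFc a σ b k) (dS k u)))
    (incl n (mS (gradFc a σ b k) (dS k u)))
  have h5 := norm_add_le (incl n (mS (hessFc a σ b k k) u)) (incl n (mS (gradFc a σ b k) (dS k u)))
  linarith [norm_nonneg (incl n (negLapS n u))]

theorem exists_norm_fieldOp_gradSum_le (ha : 0 < a) {σ : ℝ} (hσ : 1 / 2 < σ) (N : ℕ) :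
    ∃ C, ∀ u : 𝓢(Space n, ℂ), ‖incl n (fieldOp (gradSum a σ N) u)‖ ≤
      C * (‖incl n u‖ + ‖incl n (negLapS n u)‖) := by
  obtain ⟨C, -, hC⟩ := exists_norm_fieldOp_gradFc_le (n := n) ha hσ
  refine ⟨((Finset.Icc (-(N : ℤ)) N).card : ℝ) * C, fun u => ?_⟩
  have h1 : fieldOp (gradSum a σ N) =
      ∑ l ∈ Finset.Icc (-(N : ℤ)) N, fieldOp (gradFc a σ (latticePoint n l)) :=
    fieldOp_sum _ fun l _ k => gradFc_hasTemperateGrowth ha σ _ k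
  rw [h1, LinearMap.sum_apply, map_sum, mul_assoc, ← nsmul_eq_mul]
  exact (norm_sum_le _ _).trans (Finset.sum_le_card_nsmul _ _ _ fun l _ => hC _ u)

end RelativeBounds

/-! ### Passage from Schwartz functions to D(-Δ). -/

section Extension

variable {n : ℕ}

/-- A continuous operator on distributions which is relatively `-Δ`-bounded on Schwartz functions
maps `D(-Δ)` to `L²`, and is approximated there by its action on Schwartz functions. -/
theorem exists_tendsto_realize {T : Dist n →ₗ[ℂ] Dist n} (hT : Continuous T)
    {S : 𝓢(Space n, ℂ) →ₗ[ℂ] 𝓢(Space n, ℂ)}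
    (hTS : ∀ φ, T (toDist n (incl n φ)) = toDist n (incl n (S φ))) {C : ℝ}
    (hS : ∀ φ, ‖incl n (S φ)‖ ≤ C * (‖incl n φ‖ + ‖incl n (negLapS n φ)‖))
    {φ : ℕ → 𝓢(Space n, ℂ)} {u w : L2 n}
    (hu : Filter.Tendsto (fun m => incl n (φ m)) Filter.atTop (nhds u))
    (hw : Filter.Tendsto (fun m => incl n (negLapS n (φ m))) Filter.atTop (nhds w)) :
    ∃ h : u ∈ (realize T).domain,
      Filter.Tendsto (fun m => incl n (S (φ m))) Filter.atTop (nhds (realize T ⟨u, h⟩)) := by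
  have hcau : CauchySeq fun m => incl n (S (φ m)) := by
    have h1 := hu.cauchySeq
    have h2 := hw.cauchySeq
    rw [cauchySeq_iff_tendsto_dist_atTop_0] at h1 h2 ⊢
    have h3 := (h1.add h2).const_mul C
    rw [add_zero, mul_zero] at h3
    refine squeeze_zero (fun _ => dist_nonneg) (fun p => ?_) h3
    simp only [dist_eq_norm, ← map_sub]
    exact hS _
  obtain ⟨v, hv⟩ := cauchySeq_tendsto_of_complete hcau
  -- The L² limit represents T u because T is continuous on distributions and limits there are
  -- unique.
  have hv' : toDist n v = T (toDist n u) := by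
    refine tendsto_nhds_unique ((continuous_toDist.tendsto _).comp hv) ?_
    exact (((hT.comp continuous_toDist).tendsto u).comp hu).congr fun m => hTS (φ m)
  have h : u ∈ (realize T).domain := (mem_domain_realize T u).2 ⟨v, hv'⟩
  refine ⟨h, ?_⟩
  rwa [show realize T ⟨u, h⟩ = v from
    toDist_injective n ((toDist_realize T ⟨u, h⟩).trans hv'.symm)]

/-- The number `i (⟨p, q⟩ - ⟨q, p⟩)`. -/
noncomputable def bracket (p q : L2 n) : ℝ := (Complex.I * (inner ℂ p q - inner ℂ q p)).re

theorem continuous_bracket : Continuous fun p : L2 n × L2 n => bracket p.1 p.2 := by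
  unfold bracket
  fun_prop

theorem mul_bracket_le_of_tendsto {p q r : ℕ → L2 n} {p' q' r' : L2 n} {c : ℝ}
    (hp : Filter.Tendsto p Filter.atTop (nhds p')) (hq : Filter.Tendsto q Filter.atTop (nhds q'))
    (hr : Filter.Tendsto r Filter.atTop (nhds r'))
    (h : ∀ m, c * bracket (p m) (q m) ≤ bracket (r m) (q m)) :
    c * bracket p' q' ≤ bracket r' q' :=
  le_of_tendsto_of_tendsto'
    (((continuous_bracket.tendsto (p', q')).comp (hp.prodMk_nhds hq)).const_mul c)
    ((continuous_bracket.tendsto (r', q')).comp (hr.prodMk_nhds hq)) h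

theorem bracket_neg_I_smul (p q : L2 n) :
    bracket p ((-Complex.I) • q) = 2 * (inner ℂ p q).re := by
  have h := re_inner_comm p q
  rw [bracket, inner_smul_right, inner_smul_left]
  simp only [map_neg, Complex.conj_I, neg_neg, Complex.mul_re, Complex.sub_re, Complex.sub_im,
    Complex.mul_im, Complex.neg_re, Complex.neg_im, Complex.I_re, Complex.I_im]
  linarith

theorem exists_abs_latticePotential_le (M : ℕ) (V : ℤ → ℝ → ℝ)
    (hV_smooth : ∀ j ∈ Finset.Icc (-(M : ℤ)) M,
      ContDiff ℝ ((⊤ : ℕ∞) : WithTop ℕ∞) (bump n (V j) j))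
    (hV_supp : ∀ j ∈ Finset.Icc (-(M : ℤ)) M, HasCompactSupport (bump n (V j) j)) :
    ∃ C, 0 ≤ C ∧ ∀ x, |latticePotential n M V x| ≤ C := by
  have h : ∀ j : ℤ, ∃ C, 0 ≤ C ∧
      (j ∈ Finset.Icc (-(M : ℤ)) M → ∀ x, |bump n (V j) j x| ≤ C) := by
    intro j
    by_cases hj : j ∈ Finset.Icc (-(M : ℤ)) M
    · obtain ⟨C, hC⟩ := (hV_supp j hj).exists_bound_of_continuous (hV_smooth j hj).continuous
      exact ⟨C, (norm_nonneg _).trans (hC 0), fun _ => hC⟩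
    · exact ⟨0, le_rfl, fun h => absurd h hj⟩
  choose C hC0 hC using h
  exact ⟨∑ j ∈ Finset.Icc (-(M : ℤ)) M, C j, Finset.sum_nonneg fun j _ => hC0 j, fun x =>
    (Finset.abs_sum_le_sum_abs _ _).trans (Finset.sum_le_sum fun j hj => hC j hj x)⟩

theorem exists_tendsto_hamiltonian {V : Space n → ℝ} (hV : V.HasTemperateGrowth) {C : ℝ}
    (hC0 : 0 ≤ C) (hC : ∀ x, |V x| ≤ C) {φ : ℕ → 𝓢(Space n, ℂ)} {u w : L2 n}
    (hu : Filter.Tendsto (fun m => incl n (φ m)) Filter.atTop (nhds u))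
    (hw : Filter.Tendsto (fun m => incl n (negLapS n (φ m))) Filter.atTop (nhds w)) :
    ∃ h : u ∈ (hamiltonian V).domain, Filter.Tendsto
      (fun m => incl n (negLapS n (φ m)) + incl n (mS V (φ m))) Filter.atTop
        (nhds (hamiltonian V ⟨u, h⟩)) := by
  have hT : Continuous (negLaplacianDist n + mulBy V) :=
    continuous_negLaplacianDist.add (continuous_mulBy V)
  obtain ⟨h, hlim⟩ := exists_tendsto_realize hT (S := negLapS n + mS V) (C := 1 + C)
    (fun ψ => by
      rw [LinearMap.add_apply, LinearMap.add_apply, map_add, map_add, negLaplacianDist_toDist,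
        mulBy_toDist hV])
    (fun ψ => by
      rw [LinearMap.add_apply, map_add]
      have h1 := norm_mS_le hV hC0 hC ψ
      have h2 := norm_add_le (incl n (negLapS n ψ)) (incl n (mS V ψ))
      nlinarith [norm_nonneg (incl n ψ), norm_nonneg (incl n (negLapS n ψ))]) hu hw
  simp only [LinearMap.add_apply, map_add] at hlim
  exact ⟨h, hlim⟩

theorem continuous_sum_gammaDist (a σ : ℝ) (N : ℕ) : Continuous
    (∑ k ∈ Finset.Icc (-(N : ℤ)) N, gammaDist a σ (latticePoint n k) : Dist n →ₗ[ℂ] Dist n) := by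
  have h : Continuous fun u : Dist n =>
      ∑ k ∈ Finset.Icc (-(N : ℤ)) N, gammaDist a σ (latticePoint n k) u :=
    continuous_finsetSum _ fun k _ => continuous_gammaDist a σ (latticePoint n k)
  simpa only [← LinearMap.sum_apply] using h

theorem exists_tendsto_gammaN {a σ : ℝ} (ha : 0 < a) (hσ : 1 / 2 < σ) (N : ℕ)
    {φ : ℕ → 𝓢(Space n, ℂ)} {u w : L2 n}
    (hu : Filter.Tendsto (fun m => incl n (φ m)) Filter.atTop (nhds u))
    (hw : Filter.Tendsto (fun m => incl n (negLapS n (φ m))) Filter.atTop (nhds w)) :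
    ∃ h : u ∈ (gammaN n a σ N).domain, Filter.Tendsto
      (fun m => (-Complex.I) • incl n (fieldOp (gradSum a σ N) (φ m))) Filter.atTop
        (nhds (gammaN n a σ N ⟨u, h⟩)) := by
  obtain ⟨C, hC⟩ := exists_norm_fieldOp_gradSum_le (n := n) ha hσ N
  obtain ⟨h, hlim⟩ := exists_tendsto_realize (continuous_sum_gammaDist a σ N)
    (S := (-Complex.I) • fieldOp (gradSum a σ N)) (C := C)
    (fun ψ => sum_gammaDist_toDist ha σ N ψ)
    (fun ψ => by
      rw [LinearMap.smul_apply, map_smul, norm_smul, norm_neg, Complex.norm_I, one_mul]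
      exact hC ψ) hu hw
  simp only [LinearMap.smul_apply, map_smul] at hlim
  exact ⟨h, hlim⟩

theorem commForm_eq_bracket (A B : L2 n →ₗ.[ℂ] L2 n) (u : L2 n) (hA : u ∈ A.domain)
    (hB : u ∈ B.domain) : commForm A B u hA hB = bracket (A ⟨u, hA⟩) (B ⟨u, hB⟩) := rfl

end Extension

end MultiCenter

open MultiCenter in
theorem mainTheorem8 (n : ℕ) (hn : 3 ≤ n) (a σ : ℝ) (ha : 0 < a)
    (hσ : 1 / 2 < σ) (hσ' : σ < 4 * ((n : ℝ) - 2) ^ 2)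
    (M : ℕ) (V : ℤ → ℝ → ℝ)
    (hV_smooth : ∀ j ∈ Finset.Icc (-(M : ℤ)) M,
      ContDiff ℝ ((⊤ : ℕ∞) : WithTop ℕ∞) (MultiCenter.bump n (V j) j))
    (hV_supp : ∀ j ∈ Finset.Icc (-(M : ℤ)) M, HasCompactSupport (MultiCenter.bump n (V j) j))
    (hV_decr : ∀ j ∈ Finset.Icc (-(M : ℤ)) M, AntitoneOn (V j) (Set.Ici 0))
    (ε : ℝ) (hε : 0 < ε) (hε' : ε < 1) :
    ∃ Nε : ℕ, M ≤ Nε ∧ ∀ N : ℕ, Nε ≤ N →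
      ∀ (u : MultiCenter.L2 n) (hu : u ∈ (MultiCenter.negLaplacian n).domain),
        ∃ (hH : u ∈ (MultiCenter.hamiltonian (MultiCenter.latticePotential n M V)).domain)
          (hγ : u ∈ (MultiCenter.gammaN n a σ N).domain),
          (1 - ε) * MultiCenter.commForm (MultiCenter.negLaplacian n)
              (MultiCenter.gammaN n a σ N) u hu hγ ≤
            MultiCenter.commForm (MultiCenter.hamiltonian (MultiCenter.latticePotential n M V))
              (MultiCenter.gammaN n a σ N) u hH hγ := by
  obtain ⟨Nε, hMN, hineq⟩ :=
    exists_schwartz_inequality hn ha hσ hσ' M V hV_smooth hV_supp hV_decr hε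
  refine ⟨Nε, hMN, fun N hN u hu => ?_⟩
  obtain ⟨C, hC0, hC⟩ := exists_abs_latticePotential_le M V hV_smooth hV_supp
  -- A single graph-norm approximation serves -Δ, H and γ_N at once, so both brackets converge along
  -- it.
  obtain ⟨φ, hφ, hφw⟩ := exists_schwartz_seq u (negLaplacian n ⟨u, hu⟩)
    (toDist_realize (negLaplacianDist n) ⟨u, hu⟩)
  obtain ⟨hH, hHlim⟩ := exists_tendsto_hamiltonian
    (hasTemperateGrowth_latticePotential M V hV_smooth hV_supp) hC0 hC hφ hφw
  obtain ⟨hγ, hγlim⟩ := exists_tendsto_gammaN ha hσ N hφ hφw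
  refine ⟨hH, hγ, ?_⟩
  rw [commForm_eq_bracket, commForm_eq_bracket]
  refine mul_bracket_le_of_tendsto hφw hγlim hHlim fun m => ?_
  have h := hineq N hN (φ m)
  simp only [bracket_neg_I_smul, inner_add_left, Complex.add_re]
  linarith
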